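/- **Setting.** Consider the scalar system $x_{t+1}=ax_t+bu_t+d_t$, $t\ge 0$, with $|a|\ge 1$, $b\ne 0$, where $x_0$ is square integrable and $(d_t)$ is i.i.d. zero-mean Gaussian with a given variance, controlled over a discrete memoryless channel with finite input alphabet $\mathcal M$, finite output alphabet $\mathcal M'$, transition law $W(q'\mid q)$ and Shannon capacity $C=\max_p I(p;W)$ (in bits), with noiseless feedback. The channel output satisfies $P(q'_t=y\mid x_0,d_0,\dots,d_{t-1},q'_0,\dots,q'_{t-1})=W(y\mid q_t)$, and $d_t$ is independent of $(x_0,d_0,\dots,d_{t-1},q'_0,\dots,q'_t)$. **Scheme.** Fix a block length $n\ge1$, an even $K\ge 2$ with $K>\lceil |a|^n\rceil$, reals $\alpha\in(0,1)$, $\delta>0$, $L>0$ with $\log_2 K> n\log_2(|a|/\alpha)$, an encoder from the $K+1$ symbols (the $K$ bins and an overflow symbol $\mathcal Z$) to $\mathcal M^n$, a decoder from $\mathcal M'^n$ to the symbols, and $\Delta_0>L$. At time $kn$ the state $x_{kn}$ is quantized with $K$ uniform bins of size $\Delta_{kn}$ covering $[-\tfrac K2\Delta_{kn},\tfrac K2\Delta_{kn}]$,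 with symbol $\mathcal Z$ outside this interval; the symbol is encoded and sent over the channel at times $kn,\dots,(k+1)n-1$, and $c'_k$ denotes the decoder output. Let $\hat x_{kn}$ be the centre of the bin $c'_k$, and $\hat x_{kn}=0$ if $c'_k=\mathcal Z$. The control is $u_{(k+1)n-1}=-\frac{a^n}{b}\hat x_{kn}$, and $u_t=0$ at all other times. The bin size is constant on each block and $\Delta_{(k+1)n}=\Delta_{kn}\bar Q$, where $\bar Q=(|a|+\delta)^n$ if $c'_k=\mathcal Z$, $\bar Q=\alpha^n$ if $c'_k\neq\mathcal Z$ and $\Delta_{kn}\ge L$, and $\bar Q=1$ if $c'_k\ne\mathcal Z$ and $\Delta_{kn}<L$. A Borel set $A$ is *coordinate-recurrent* for a process $(Z_m)_{m\ge0}$ if $\sum_{m=0}^\infty 1_{\{Z_m\in A\}}=\infty$ almost surely. **Theorem.** Suppose that $C>\log_2|a|$. Then there is $\alpha_0\in(0,1)$ such that for all $\alpha\in[\alpha_0,1)$, $\delta>0$ and $L>0$ and for all sufficiently large $n$ the following holds. There are an even $K\ge 2$ with $K>\lceil |a|^n\rceil$ and $\log_2K>n\log_2(|a|/\alpha)$,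 an encoder and a decoder as above, and a compact set $A\subset\mathbb R\times(0,\infty)$, such that for every initial bin size $\Delta_0>L$ and every law of the square integrable initial state $x_0$, the set $A$ is coordinate-recurrent for the process $(x_t,\Delta_t)_{t\ge0}$ and for the sampled process $(x_{kn},\Delta_{kn})_{k\ge0}$. -/

import Mathlib

open MeasureTheory ProbabilityTheory
open scoped NNReal ENNReal

/-- Mutual information `I(p; W)`, in bits, between the input and the output of the discrete
memoryless channel `W` when the input has law `p`. Terms with `p x * W x y = 0` vanish. -/
noncomputable def mutualInfo {X Y : Type*} [Fintype X] [Fintype Y]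
    (W : X → PMF Y) (p : X → ℝ) : ℝ :=
  ∑ x, ∑ y, p x * (W x y).toReal *
    Real.logb 2 ((W x y).toReal / ∑ x', p x' * (W x' y).toReal)

/-- Shannon capacity, in bits per channel use, of the discrete memoryless channel `W`. -/
noncomputable def capacity {X Y : Type*} [Fintype X] [Fintype Y] (W : X → PMF Y) : ℝ :=
  sSup (mutualInfo W '' stdSimplex ℝ X)

/-- The supremum defining the capacity is a genuine (finite) one. -/
theorem bddAbove_mutualInfo {X Y : Type*} [Fintype X] [Fintype Y] (W : X → PMF Y) :
    BddAbove (mutualInfo W '' stdSimplex ℝ X) := by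
  refine ⟨∑ _x : X, ∑ _y : Y, 1 / Real.log 2, ?_⟩
  rintro _ ⟨p, ⟨hp0, hp1⟩, rfl⟩
  refine Finset.sum_le_sum fun x _ => Finset.sum_le_sum fun y _ => ?_
  have hl : 0 < Real.log 2 := Real.log_pos (by norm_num)
  have hw0 : 0 ≤ (W x y).toReal := ENNReal.toReal_nonneg
  have hw1 : (W x y).toReal ≤ 1 :=
    ENNReal.toReal_le_of_le_ofReal zero_le_one (by simpa using PMF.coe_le_one (W x) y)
  rcases hw0.eq_or_lt with hw | hw
  · rw [← hw]; simp; positivity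
  rcases (hp0 x).eq_or_lt with hp | hp
  · rw [← hp]; simp; positivity
  have hq : p x * (W x y).toReal ≤ ∑ x', p x' * (W x' y).toReal :=
    Finset.single_le_sum (f := fun x' => p x' * (W x' y).toReal)
      (fun i _ => mul_nonneg (hp0 i) ENNReal.toReal_nonneg) (Finset.mem_univ x)
  set q := ∑ x', p x' * (W x' y).toReal
  have hpw : 0 < p x * (W x y).toReal := mul_pos hp hw
  have hqpos : 0 < q := hpw.trans_le hq
  have h1 : (W x y).toReal / q ≤ (p x)⁻¹ := by
    rw [div_le_iff₀ hqpos, inv_mul_eq_div, le_div_iff₀ hp]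
    linarith
  have h2 : Real.log ((W x y).toReal / q) ≤ (p x)⁻¹ :=
    (Real.log_le_self (by positivity)).trans h1
  rw [Real.logb, ← mul_div_assoc]
  gcongr
  calc p x * (W x y).toReal * Real.log ((W x y).toReal / q)
      ≤ p x * (W x y).toReal * (p x)⁻¹ := by gcongr
    _ = (W x y).toReal := by field_simp
    _ ≤ 1 := hw1

/-- `x` lies in the granular bin number `k` (counted from `0`) of the uniform quantizer with `K`
bins of size `Δ`; the last bin is closed on the right. -/
def InBin (K : ℕ) (Δ : ℝ) (k : Fin K) (x : ℝ) : Prop :=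
  (((k : ℝ) - K / 2) * Δ ≤ x ∧ x < ((k : ℝ) + 1 - K / 2) * Δ) ∨
    ((k : ℕ) + 1 = K ∧ x = K / 2 * Δ)

open Classical in
/-- Uniform quantizer: the symbol `some k` for a granular bin, `none` for the overflow symbol. The
`K + 1` elements of `Option (Fin K)` are the messages sent over the channel. -/
noncomputable def quantize (K : ℕ) (Δ x : ℝ) : Option (Fin K) :=
  if h : ∃ k, InBin K Δ k x then some h.choose else none

/-- Reconstruction: the centre of the bin, and `0` for the overflow symbol. -/
noncomputable def reconstruct (K : ℕ) (Δ : ℝ) : Option (Fin K) → ℝ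
  | some k => ((k : ℝ) + 1 / 2 - K / 2) * Δ
  | none => 0

theorem InBin.unique {K : ℕ} {Δ x : ℝ} (hΔ : 0 < Δ) {j k : Fin K}
    (hj : InBin K Δ j x) (hk : InBin K Δ k x) : j = k := by
  have key : ∀ {j k : Fin K}, InBin K Δ j x → InBin K Δ k x → (j : ℕ) ≤ k := by
    intro j k hj hk
    by_contra! hlt
    have hc : ((k : ℕ) : ℝ) + 1 ≤ (j : ℕ) := by exact_mod_cast hlt
    have hjK : ((j : ℕ) : ℝ) + 1 ≤ K := by exact_mod_cast j.2
    rcases hk with ⟨-, h2⟩ | ⟨h1, -⟩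
    · have h3 : x < ((j : ℝ) - K / 2) * Δ := h2.trans_le (by gcongr)
      rcases hj with ⟨h4, -⟩ | ⟨-, h4⟩
      · linarith
      · nlinarith
    · have := j.2
      omega
  exact Fin.ext (le_antisymm (key hj hk) (key hk hj))

theorem quantize_eq_some_iff {K : ℕ} {Δ x : ℝ} (hΔ : 0 < Δ) {k : Fin K} :
    quantize K Δ x = some k ↔ InBin K Δ k x := by
  unfold quantize
  split_ifs with h
  · constructor
    · intro hk
      rw [← Option.some.inj hk]
      exact h.choose_spec
    · intro hk
      rw [InBin.unique hΔ h.choose_spec hk]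
  · simp only [false_iff]
    exact fun hk => h ⟨k, hk⟩

/-- The overflow symbol is emitted exactly outside the granular region. -/
theorem quantize_eq_none_iff {K : ℕ} {Δ x : ℝ} (hK : 0 < K) (hΔ : 0 < Δ) :
    quantize K Δ x = none ↔ K / 2 * Δ < |x| := by
  have hiff : (∃ k, InBin K Δ k x) ↔ |x| ≤ K / 2 * Δ := by
    constructor
    · rintro ⟨k, ⟨h1, h2⟩ | ⟨-, h2⟩⟩
      · have hk0 : (0 : ℝ) ≤ k := by positivity
        have hk1 : ((k : ℕ) : ℝ) + 1 ≤ K := by exact_mod_cast k.2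
        rw [abs_le]
        constructor <;> nlinarith
      · rw [h2, abs_of_nonneg (by positivity)]
    · intro h
      rw [abs_le] at h
      rcases h.2.eq_or_lt with h2 | h2
      · exact ⟨⟨K - 1, by omega⟩, Or.inr ⟨by simp; omega, h2⟩⟩
      · have h0 : 0 ≤ x / Δ + K / 2 := by
          have : -(K / 2 : ℝ) ≤ x / Δ := by rw [le_div_iff₀ hΔ]; linarith
          linarith
        have hlt : x / Δ + K / 2 < K := by
          have : x / Δ < (K / 2 : ℝ) := by rw [div_lt_iff₀ hΔ]; linarith
          linarith
        refine ⟨⟨⌊x / Δ + K / 2⌋₊, (Nat.floor_lt h0).2 hlt⟩, Or.inl ⟨?_, ?_⟩⟩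
        · have := Nat.floor_le h0
          rw [← le_div_iff₀ hΔ]
          simp only
          linarith
        · have := Nat.lt_floor_add_one (x / Δ + K / 2)
          rw [← div_lt_iff₀ hΔ]
          simp only
          linarith
  rw [← not_le, ← hiff]
  unfold quantize
  split_ifs with h <;> simp [h]

/-- Factor by which the bin size is multiplied over a block of length `n` when the decoder output
is `c`. -/
noncomputable def zoomFactor (a α δ L : ℝ) (n : ℕ) {K : ℕ} (Δ : ℝ) : Option (Fin K) → ℝ
  | none => (|a| + δ) ^ n
  | some _ => if L ≤ Δ then α ^ n else 1

/-- A block code of length `n` for the `K + 1` quantizer symbols, over a channel with input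
alphabet `X` and output alphabet `Y`. -/
structure BlockCode (X Y : Type*) (n K : ℕ) where
  /-- the channel encoder -/
  enc : Option (Fin K) → Fin n → X
  /-- the channel decoder -/
  dec : (Fin n → Y) → Option (Fin K)

/-- The decoder output at the end of the block of times `k * n, …, (k + 1) * n - 1`. -/
def BlockCode.decoded {X Y Ω : Type*} {n K : ℕ} (C : BlockCode X Y n K) (q' : ℕ → Ω → Y)
    (k : ℕ) (ω : Ω) : Option (Fin K) :=
  C.dec fun i => q' (k * n + i) ω

/-- The σ-algebra generated by `x₀`, `d₀, …, d_{t-1}` and `q'₀, …, q'_{t-1}`. -/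
@[reducible] def history {Ω Y : Type*} [MeasurableSpace Y] (x₀ : Ω → ℝ) (d : ℕ → Ω → ℝ) (q' : ℕ → Ω → Y)
    (t : ℕ) : MeasurableSpace Ω :=
  MeasurableSpace.comap x₀ inferInstance ⊔
    ⨆ s : Fin t, (MeasurableSpace.comap (d s) inferInstance ⊔
      MeasurableSpace.comap (q' s) inferInstance)

/-- On the probability space `(Ω, μ)`, the state `x`, noise `d`, control `u`, bin size `Δ`, channel
input `q` and channel output `q'` form the closed loop made of the system
`x_{t+1} = a x_t + b u_t + d_t`, the memoryless channel `W` with feedback, and the adaptive zooming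
quantizer and controller with parameters `α, δ, L`, block code `C` and initial bin size `Δ₀`. -/
structure IsClosedLoop {Ω X Y : Type*} [MeasurableSpace Ω] [MeasurableSpace Y] (μ : Measure Ω)
    (a b : ℝ) (v : ℝ≥0) (W : X → PMF Y) (α δ L : ℝ) {n K : ℕ} (C : BlockCode X Y n K) (Δ₀ : ℝ)
    (x d u Δ : ℕ → Ω → ℝ) (q : ℕ → Ω → X) (q' : ℕ → Ω → Y) : Prop where
  measurable_init : Measurable (x 0)
  measurable_noise : ∀ t, Measurable (d t)
  measurable_output : ∀ t, Measurable (q' t)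
  /-- the initial state is a second order random variable -/
  memLp_init : MemLp (x 0) 2 μ
  /-- the noise is i.i.d., centred Gaussian with variance `v`, and independent of the initial
  state and of the randomness of the channel -/
  noise_law : ∀ t, μ.map (d t) = gaussianReal 0 v
  noise_indep : ∀ t, Indep (MeasurableSpace.comap (d t) inferInstance)
    (history (x 0) d q' t ⊔ MeasurableSpace.comap (q' t) inferInstance) μ
  /-- given the past, the channel output at time `t` has law `W (q t)` -/
  channel_law : ∀ t y,
    μ⟦q' t ⁻¹' {y} | history (x 0) d q' t⟧ =ᵐ[μ] fun ω => (W (q t ω) y).toReal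
  state_eq : ∀ t ω, x (t + 1) ω = a * x t ω + b * u t ω + d t ω
  /-- at time `k * n` the state is quantized and the symbol is encoded over the next `n` times -/
  input_eq : ∀ k (i : Fin n) ω,
    q (k * n + i) ω = C.enc (quantize K (Δ (k * n) ω) (x (k * n) ω)) i
  /-- the control acts only at the last time of each block -/
  control_eq : ∀ t ω, u t ω =
    if n ∣ t + 1 then
      -(a ^ n / b) * reconstruct K (Δ (t / n * n) ω) (C.decoded q' (t / n) ω)
    else 0
  bin_init : ∀ ω, Δ 0 ω = Δ₀
  bin_hold : ∀ k (i : Fin n) ω, Δ (k * n + i) ω = Δ (k * n) ω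
  bin_update : ∀ k ω, Δ ((k + 1) * n) ω =
    Δ (k * n) ω * zoomFactor a α δ L n (Δ (k * n) ω) (C.decoded q' k ω)

/-- A Borel set visited infinitely often, almost surely, by the process `Z`. -/
def IsCoordinateRecurrent {Ω E : Type*} [MeasurableSpace Ω] [MeasurableSpace E] (μ : Measure Ω)
    (Z : ℕ → Ω → E) (A : Set E) : Prop :=
  MeasurableSet A ∧ ∀ᵐ ω ∂μ, ∑' m, A.indicator (fun _ => (1 : ℝ≥0∞)) (Z m ω) = ∞

/-! Sample at the block ends `k * n` and use the Lyapunov function `Real.log (Δ / s) + B *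
overflowCost θ ρ`. Here `s = α ^ n * L` is the smallest reachable bin size and `ρ = 2|x| / (KΔ)`
exceeds 1 exactly on overflow. Outside a rectangle it falls by at least `-Real.log (α ^ n)` per
block, up to noise, whenever decoding is correct. In range, the bin shrinks by `α ^ n` and the new
`ρ` is at most 1/2 plus noise. On overflow, the bin grows by `(|a| + δ) ^ n` but `ρ` is divided by
`((|a| + δ) / |a|) ^ n`, whose logarithm is `θ`; the weight `B` makes the gain `B * θ` outweigh the
growth of the bin (`lyapunov_step_le`).

Two perturbations remain. A decoding error costs O(n), the same order as the drift, so an error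
probability that is small but constant in `n` suffices. Feinstein's lemma with a Chernoff bound on
the information density provides it at rates below capacity, for every message and hence whatever
the past (`exists_blockCode_error_le`, `measureReal_decoded_ne_le`). The accumulated noise, relative
to the quantizer range, contributes O(n² (S/T)^n), where `|a| / α ≤ S < T` and `K ≥ 2 T ^ n`.

For large `n` each perturbation uses at most a quarter of the drift. Foster's criterion
(`ae_frequently_mem_of_drift`) then gives infinitely many visits to the rectangle at block ends,
hence also for the full process. -/

/-! ### Channel coding below capacity. -/

open Classical in
/-- Feinstein's lemma: a greedy choice of codewords gives a code with small maximal error. -/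
theorem exists_code_maxError_le {A B ι : Type*} [Fintype A] [Fintype B] [Fintype ι]
    (w : A → B → ℝ) (hw0 : ∀ x y, 0 ≤ w x y) (hw1 : ∀ x, ∑ y, w x y = 1)
    (P : A → ℝ) (hP : P ∈ stdSimplex ℝ A) {T ε : ℝ} (hT : 0 < T)
    (h : Fintype.card ι / T + ∑ x, ∑ y,
      (if w x y ≤ T * ∑ x', P x' * w x' y then P x * w x y else 0) ≤ ε) :
    ∃ (enc : ι → A) (dec : B → Option ι), ∀ i, ∑ y with dec y ≠ some i, w (enc i) y ≤ ε := by
  set Q : B → ℝ := fun y => ∑ x', P x' * w x' y with hQ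
  have hA : Nonempty A := by
    by_contra hA
    rw [not_nonempty_iff] at hA
    have := hP.2
    simp at this
  have key : ∀ S : Finset ι, ∃ (enc : ι → A) (dec : B → Option ι),
      (∀ y i, dec y = some i → i ∈ S ∧ T * Q y < w (enc i) y) ∧
      ∀ i ∈ S, ∑ y with dec y ≠ some i, w (enc i) y ≤ ε := by
    intro S
    induction S using Finset.induction_on with
    | empty => exact ⟨fun _ => hA.some, fun _ => none, by simp, by simp⟩
    | insert j S hj ih =>
      obtain ⟨enc, dec, hd, he⟩ := ih
      -- If every new codeword failed, averaging over `P` would bound `ε` by the low-density mass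
      -- plus the `Q`-mass of the outputs already assigned. An output assigned to `i` has `Q y < w
      -- (enc i) y / T`, so that mass is at most `S.card / T`, strictly below the allowance since `j
      -- ∉ S`.
      have hx : ∃ x, ∑ y with ¬ (dec y = none ∧ T * Q y < w x y), w x y ≤ ε := by
        by_contra hc
        have hcon := fun x => not_le.1 fun hx => hc ⟨x, hx⟩
        have h1 : ε ≤ ∑ x, P x * ∑ y with ¬ (dec y = none ∧ T * Q y < w x y), w x y := by
          calc ε = ∑ x, P x * ε := by rw [← Finset.sum_mul, hP.2, one_mul]
            _ ≤ _ := Finset.sum_le_sum fun x _ =>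
              mul_le_mul_of_nonneg_left (hcon x).le (hP.1 x)
        have h2 : ∑ x, P x * ∑ y with ¬ (dec y = none ∧ T * Q y < w x y), w x y ≤
            ∑ x, ∑ y, ((if w x y ≤ T * Q y then P x * w x y else 0) +
              if dec y ≠ none then P x * w x y else 0) := by
          refine Finset.sum_le_sum fun x _ => ?_
          rw [Finset.sum_filter, Finset.mul_sum]
          refine Finset.sum_le_sum fun y _ => ?_
          have := mul_nonneg (hP.1 x) (hw0 x y)
          by_cases h3 : dec y = none <;> by_cases h4 : w x y ≤ T * Q y <;>
            simp [h3, h4, this]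
        have h3 : ∑ x, ∑ y, (if dec y ≠ none then P x * w x y else 0) ≤ S.card / T := by
          rw [Finset.sum_comm]
          calc ∑ y, ∑ x, (if dec y ≠ none then P x * w x y else 0)
              = ∑ y, if dec y ≠ none then Q y else 0 := by
                refine Finset.sum_congr rfl fun y _ => ?_
                split_ifs <;> simp [hQ]
            _ ≤ ∑ y, ∑ i ∈ S, if dec y = some i then w (enc i) y / T else 0 := by
                refine Finset.sum_le_sum fun y _ => ?_
                rcases hdy : dec y with _ | i
                · simp
                · obtain ⟨hi, hlt⟩ := hd y i hdy
                  simp only [ne_eq, reduceCtorEq, not_false_eq_true, if_true, Option.some.injEq]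
                  rw [Finset.sum_ite_eq S i, if_pos hi, le_div_iff₀ hT]
                  linarith
            _ = ∑ i ∈ S, ∑ y, if dec y = some i then w (enc i) y / T else 0 :=
                Finset.sum_comm
            _ ≤ ∑ i ∈ S, 1 / T := by
                refine Finset.sum_le_sum fun i _ => ?_
                rw [← hw1 (enc i), Finset.sum_div]
                refine Finset.sum_le_sum fun y _ => ?_
                have := div_nonneg (hw0 (enc i) y) hT.le
                split_ifs <;> linarith
            _ = S.card / T := by simp [div_eq_mul_inv]
        have h4 : (S.card : ℝ) / T < Fintype.card ι / T := by
          gcongr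
          exact Finset.card_lt_univ_of_notMem hj
        simp only [Finset.sum_add_distrib] at h2
        linarith
      obtain ⟨x, hx⟩ := hx
      -- The new message claims only unassigned outputs, so the decoding regions of the earlier
      -- messages are untouched.
      refine ⟨Function.update enc j x,
        fun y => if dec y = none ∧ T * Q y < w x y then some j else dec y, ?_, ?_⟩
      · intro y i hi
        by_cases hc : dec y = none ∧ T * Q y < w x y
        · simp only [hc, and_self, if_true, Option.some.injEq] at hi
          subst hi
          simp [hc.2]
        · simp only [hc, if_false] at hi
          obtain ⟨hiS, hlt⟩ := hd y i hi
          have hij : i ≠ j := fun h => hj (h ▸ hiS)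
          simp [hiS, Function.update_of_ne hij, hlt]
      · intro i hi
        by_cases hij : i = j
        · subst hij
          simp only [Function.update_self]
          refine le_trans (Finset.sum_le_sum_of_subset_of_nonneg ?_ fun y _ _ => hw0 x y) hx
          intro y
          simp only [Finset.mem_filter, Finset.mem_univ, true_and]
          intro h1 h2
          simp [h2] at h1
        · have hiS : i ∈ S := (Finset.mem_insert.1 hi).resolve_left hij
          rw [Function.update_of_ne hij]
          refine le_trans (Finset.sum_le_sum_of_subset_of_nonneg ?_ fun y _ _ => hw0 _ y) (he i hiS)
          intro y
          simp only [Finset.mem_filter, Finset.mem_univ, true_and]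
          intro h1 h2
          apply h1
          simp [h2]
  obtain ⟨enc, dec, -, he⟩ := key Finset.univ
  exact ⟨enc, dec, fun i => he i (Finset.mem_univ i)⟩

theorem PMF.sum_toReal {Y : Type*} [Fintype Y] (p : PMF Y) : ∑ y, (p y).toReal = 1 := by
  rw [← ENNReal.toReal_sum fun y _ => p.apply_ne_top y, ← tsum_fintype (L := .unconditional Y),
    p.tsum_coe, ENNReal.toReal_one]

theorem sum_sum_prod_eq_pow {X Y : Type*} [Fintype X] [Fintype Y] (f : X → Y → ℝ) (n : ℕ) :
    ∑ x : Fin n → X, ∑ y : Fin n → Y, ∏ i, f (x i) (y i) = (∑ x, ∑ y, f x y) ^ n := by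
  classical
  calc ∑ x : Fin n → X, ∑ y : Fin n → Y, ∏ i, f (x i) (y i)
      = ∑ x : Fin n → X, ∏ i, ∑ y, f (x i) y := by
        refine Finset.sum_congr rfl fun x _ => ?_
        rw [Finset.prod_univ_sum, Fintype.piFinset_univ]
    _ = (∑ x, ∑ y, f x y) ^ n := by
        rw [← Fin.prod_const, Finset.prod_univ_sum, Fintype.piFinset_univ]

/-- Chernoff exponent: a sum of weighted powers drops below its value at exponent zero. -/
theorem exists_sum_rpow_lt_one {ι : Type*} [Fintype ι] (c z : ι → ℝ)
    (hz : ∀ i, c i ≠ 0 → 0 < z i) (hc : ∑ i, c i = 1) (hlog : ∑ i, c i * Real.log (z i) < 0) :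
    ∃ s : ℝ, 0 < s ∧ ∑ i, c i * z i ^ s < 1 := by
  -- The sum equals 1 at exponent 0 and has negative derivative there. Terms of weight zero are
  -- constant, so the sign of their `z i` does not matter.
  have hd : HasDerivAt (fun s : ℝ => ∑ i, c i * z i ^ s) (∑ i, c i * Real.log (z i)) 0 := by
    refine HasDerivAt.fun_sum fun i _ => ?_
    by_cases hci : c i = 0
    · simpa [hci] using hasDerivAt_const (0 : ℝ) (0 : ℝ)
    · simpa using ((Real.hasStrictDerivAt_const_rpow (hz i hci) 0).hasDerivAt).const_mul (c i)
  have hlt : ∀ᶠ s in nhdsWithin (0 : ℝ) (Set.Ioi 0),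
      slope (fun s : ℝ => ∑ i, c i * z i ^ s) 0 s < 0 :=
    ((hasDerivAt_iff_tendsto_slope.1 hd).mono_left
      (nhdsWithin_mono _ fun s (hs : 0 < s) => hs.ne')).eventually (gt_mem_nhds hlog)
  obtain ⟨s, hs, hs0⟩ := (hlt.and self_mem_nhdsWithin).exists
  refine ⟨s, hs0, ?_⟩
  have hs0' : (0 : ℝ) < s := hs0
  rw [slope_def_field, div_lt_iff₀ (by linarith)] at hs
  simp only [Real.rpow_zero, mul_one, hc, zero_mul] at hs
  linarith

open Classical in
/-- The information density of `n` independent uses of a channel is rarely below a threshold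
smaller than the mutual information. -/
theorem exists_infoDensity_tail {X Y : Type*} [Fintype X] [Fintype Y] (W : X → PMF Y)
    {p : X → ℝ} (hp : p ∈ stdSimplex ℝ X) {T : ℝ} (hT : 0 < T)
    (hI : Real.logb 2 T < mutualInfo W p) :
    ∃ φ : ℝ, 0 ≤ φ ∧ φ < 1 ∧ ∀ n : ℕ, ∑ x : Fin n → X, ∑ y : Fin n → Y,
      (if ∏ i, (W (x i) (y i)).toReal ≤
          T ^ n * ∑ x' : Fin n → X, (∏ i, p (x' i)) * ∏ i, (W (x' i) (y i)).toReal
        then (∏ i, p (x i)) * ∏ i, (W (x i) (y i)).toReal else 0) ≤ φ ^ n := by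
  set w : X → Y → ℝ := fun x y => (W x y).toReal with hw
  set Q : Y → ℝ := fun y => ∑ x, p x * w x y with hQ
  have hw0 : ∀ x y, 0 ≤ w x y := fun x y => ENNReal.toReal_nonneg
  have hQ0 : ∀ y, 0 ≤ Q y := fun y => Finset.sum_nonneg fun x _ => mul_nonneg (hp.1 x) (hw0 x y)
  have hpos : ∀ x y, p x * w x y ≠ 0 → 0 < w x y ∧ 0 < Q y := by
    intro x y h
    have hpw : 0 < p x * w x y := lt_of_le_of_ne (mul_nonneg (hp.1 x) (hw0 x y)) h.symm
    refine ⟨pos_of_mul_pos_right hpw (hp.1 x), hpw.trans_le ?_⟩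
    exact Finset.single_le_sum (f := fun x' => p x' * w x' y)
      (fun i _ => mul_nonneg (hp.1 i) (hw0 i y)) (Finset.mem_univ x)
  have hsum : ∑ i : X × Y, p i.1 * w i.1 i.2 = 1 := by
    rw [Fintype.sum_prod_type]
    simp only [← Finset.mul_sum, hw, PMF.sum_toReal, mul_one]
    exact hp.2
  -- The mean of `log (T Q / w)` is `log T - I(p; W) log 2`, which is negative by `hI`.
  obtain ⟨s, hs, hlt⟩ := exists_sum_rpow_lt_one (fun i : X × Y => p i.1 * w i.1 i.2)
    (fun i => T * Q i.2 / w i.1 i.2)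
    (fun i hi => div_pos (mul_pos hT (hpos _ _ hi).2) (hpos _ _ hi).1) hsum (by
      have h1 : ∀ i : X × Y, p i.1 * w i.1 i.2 * Real.log (T * Q i.2 / w i.1 i.2) =
          p i.1 * w i.1 i.2 * Real.log T -
            p i.1 * w i.1 i.2 * Real.logb 2 (w i.1 i.2 / Q i.2) * Real.log 2 := by
        intro i
        by_cases hi : p i.1 * w i.1 i.2 = 0
        · simp [hi]
        · obtain ⟨hwp, hQp⟩ := hpos _ _ hi
          have hl : Real.log 2 ≠ 0 := (Real.log_pos (by norm_num)).ne'
          rw [Real.log_div (by positivity) hwp.ne', Real.log_mul hT.ne' hQp.ne', Real.logb,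
            Real.log_div hwp.ne' hQp.ne']
          field_simp
          ring
      simp only [h1, Finset.sum_sub_distrib, ← Finset.sum_mul, hsum, Fintype.sum_prod_type]
      rw [one_mul]
      have h2 : Real.log T < mutualInfo W p * Real.log 2 := by
        rwa [Real.logb, div_lt_iff₀ (Real.log_pos (by norm_num))] at hI
      have h3 : mutualInfo W p = ∑ x, ∑ y, p x * w x y * Real.logb 2 (w x y / Q y) := rfl
      rw [h3] at h2
      linarith)
  have hf0 : ∀ x y, 0 ≤ p x * w x y * (T * Q y / w x y) ^ s := fun x y =>
    mul_nonneg (mul_nonneg (hp.1 x) (hw0 x y))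
      (Real.rpow_nonneg (div_nonneg (mul_nonneg hT.le (hQ0 y)) (hw0 x y)) s)
  rw [Fintype.sum_prod_type] at hlt
  refine ⟨_, Finset.sum_nonneg fun x _ => Finset.sum_nonneg fun y _ => hf0 x y, hlt, fun n => ?_⟩
  rw [← sum_sum_prod_eq_pow]
  refine Finset.sum_le_sum fun x _ => Finset.sum_le_sum fun y _ => ?_
  have hQn : ∑ x' : Fin n → X, (∏ i, p (x' i)) * ∏ i, w (x' i) (y i) = ∏ i, Q (y i) := by
    rw [hQ, Finset.prod_univ_sum, Fintype.piFinset_univ]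
    simp only [Finset.prod_mul_distrib]
  rw [hQn]
  have hprod : 0 ≤ ∏ i, (p (x i) * w (x i) (y i) * (T * Q (y i) / w (x i) (y i)) ^ s) :=
    Finset.prod_nonneg fun i _ => hf0 _ _
  split_ifs with hbad
  -- On the bad event the product of the ratios `T Q / w` is at least 1, so its `s`-th power
  -- dominates the indicator. A zero factor is treated apart: it kills the left side and could make
  -- a denominator vanish.
  · by_cases h0 : ∃ i, p (x i) * w (x i) (y i) = 0
    · obtain ⟨i, hi⟩ := h0
      rw [← Finset.prod_mul_distrib, Finset.prod_eq_zero (Finset.mem_univ i) hi]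
      exact hprod
    · push Not at h0
      rw [Finset.prod_mul_distrib, Finset.prod_mul_distrib, Real.finsetProd_rpow _ _ (fun i _ =>
        div_nonneg (mul_nonneg hT.le (hQ0 _)) (hw0 _ _))]
      refine le_mul_of_one_le_right (mul_nonneg (Finset.prod_nonneg fun i _ => hp.1 _)
        (Finset.prod_nonneg fun i _ => hw0 _ _)) (Real.one_le_rpow ?_ hs.le)
      rw [Finset.prod_div_distrib, Finset.prod_mul_distrib, Fin.prod_const,
        one_le_div (Finset.prod_pos fun i _ => (hpos _ _ (h0 i)).1)]
      exact hbad
  · exact hprod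

open Classical in
/-- Channel coding theorem: at rates below capacity there are block codes whose maximal error
probability is as small as desired. -/
theorem exists_blockCode_error_le {X Y : Type*} [Fintype X] [Fintype Y] (W : X → PMF Y)
    {T : ℝ} (hT : 1 ≤ T) (hC : Real.logb 2 T < capacity W) (c : ℝ) {ε : ℝ} (hε : 0 < ε) :
    ∀ᶠ n : ℕ in Filter.atTop, ∀ K : ℕ, (K + 1 : ℝ) ≤ c * T ^ n →
      ∃ C : BlockCode X Y n K, ∀ m,
        ∑ y with C.dec y ≠ m, ∏ i, (W (C.enc m i) (y i)).toReal ≤ ε := by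
  -- For an empty input alphabet `sSup ∅ = 0` makes the capacity zero, contradicting `hC` and `1 ≤
  -- T`.
  have hne : (stdSimplex ℝ X).Nonempty := by
    by_contra hne
    rw [Set.not_nonempty_iff_eq_empty] at hne
    have h0 : capacity W = 0 := by simp [capacity, hne]
    have := Real.logb_nonneg (b := 2) (by norm_num) hT
    linarith
  obtain ⟨_, ⟨p, hp, rfl⟩, hI⟩ := exists_lt_of_lt_csSup (hne.image (mutualInfo W)) hC
  obtain ⟨l, hl1, hl2⟩ := exists_between hI
  have hT0 : 0 < T := by linarith
  -- The threshold rate `T'` lies strictly between the code rate `T` and the mutual information: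
  -- both Feinstein terms then decay geometrically.
  set T' : ℝ := 2 ^ l with hT'
  have hT'0 : 0 < T' := by positivity
  have hTT' : T < T' := (Real.logb_lt_iff_lt_rpow (by norm_num) hT0).1 hl1
  obtain ⟨φ, hφ0, hφ1, hφ⟩ := exists_infoDensity_tail W hp hT'0
    (by rwa [hT', Real.logb_rpow (by norm_num) (by norm_num)])
  have hlim : Filter.Tendsto (fun n : ℕ => c * (T / T') ^ n + φ ^ n) Filter.atTop (nhds 0) := by
    simpa using ((tendsto_pow_atTop_nhds_zero_of_lt_one (by positivity)
      ((div_lt_one hT'0).2 hTT')).const_mul c).add (tendsto_pow_atTop_nhds_zero_of_lt_one hφ0 hφ1)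
  filter_upwards [hlim.eventually (gt_mem_nhds hε)] with n hn K hK
  obtain ⟨enc, dec, h⟩ := exists_code_maxError_le (ι := Option (Fin K))
    (fun (x : Fin n → X) (y : Fin n → Y) => ∏ i, (W (x i) (y i)).toReal)
    (fun x y => Finset.prod_nonneg fun i _ => ENNReal.toReal_nonneg)
    (fun x => by
      rw [← Fintype.piFinset_univ, ← Finset.prod_univ_sum (fun _ => Finset.univ)
        (fun i y => (W (x i) y).toReal)]
      simp [PMF.sum_toReal])
    (fun x => ∏ i, p (x i))
    ⟨fun x => Finset.prod_nonneg fun i _ => hp.1 _, by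
      rw [← Fintype.piFinset_univ, ← Finset.prod_univ_sum (fun _ => Finset.univ) (fun _ x => p x)]
      simp [hp.2]⟩
    (T := T' ^ n) (ε := ε) (by positivity) (by
      refine le_trans (add_le_add ?_ (hφ n)) hn.le
      rw [div_pow, ← mul_div_assoc]
      gcongr
      simpa using hK)
  -- Outputs left unassigned are read as the overflow symbol, which can only shrink the error sets.
  refine ⟨⟨enc, fun y => (dec y).getD none⟩, fun m => le_trans ?_ (h m)⟩
  refine Finset.sum_le_sum_of_subset_of_nonneg ?_ fun y _ _ =>
    Finset.prod_nonneg fun i _ => ENNReal.toReal_nonneg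
  intro y
  simp only [Finset.mem_filter, Finset.mem_univ, true_and]
  intro h1 h2
  apply h1
  rw [h2, Option.getD_some]

/-! ### The Lyapunov function and its one-block drift. -/

/-- Cost charged when the state exceeds the quantizer range by the factor `ρ > 1`. -/
noncomputable def overflowCost (θ ρ : ℝ) : ℝ :=
  open Classical in if 1 < ρ then Real.log ρ + θ else 0

theorem overflowCost_nonneg {θ : ℝ} (hθ : 0 ≤ θ) (ρ : ℝ) : 0 ≤ overflowCost θ ρ := by
  unfold overflowCost
  split_ifs with h
  · exact add_nonneg (Real.log_nonneg h.le) hθ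
  · exact le_rfl

theorem log_le_log_add_of_le_add {ρ r η : ℝ} (hρ : 0 < ρ) (hr : 0 < r) (h : ρ ≤ r + η) :
    Real.log ρ ≤ Real.log r + η / r := by
  have h1 := Real.log_le_sub_one_of_pos (div_pos hρ hr)
  rw [Real.log_div hρ.ne' hr.ne'] at h1
  have h2 : ρ / r ≤ 1 + η / r := by
    rw [div_le_iff₀ hr, add_mul, div_mul_cancel₀ _ hr.ne']
    linarith
  linarith

/-- The crude bound used after a decoding error. -/
theorem overflowCost_le_of_le_add {θ ρ r η : ℝ} (hθ : 0 ≤ θ) (hη : 0 ≤ η) (hr : 1 ≤ r)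
    (h : ρ ≤ r + η) : overflowCost θ ρ ≤ Real.log r + θ + η := by
  have h0 := Real.log_nonneg hr
  unfold overflowCost
  split_ifs with hρ
  · have h1 := log_le_log_add_of_le_add (by linarith) (by linarith) h
    have h2 := div_le_self hη hr
    linarith
  · linarith

/-- Used after correct decoding in range. A positive cost requires `η > 1 / 2`, so the jump `θ` is
at most `2 * θ * η`: the discontinuity of the cost is paid for linearly by the noise. -/
theorem overflowCost_le_of_le_half_add {θ ρ η : ℝ} (hθ : 0 ≤ θ) (hη : 0 ≤ η)
    (h : ρ ≤ 1 / 2 + η) : overflowCost θ ρ ≤ (1 + 2 * θ) * η := by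
  unfold overflowCost
  split_ifs with hρ
  · have h1 := Real.log_le_sub_one_of_pos (show 0 < ρ by linarith)
    nlinarith
  · positivity

/-- Used after a correctly decoded overflow. If the overflow persists, the logarithm drops by `θ`;
if it ends, the additive `θ` itself disappears. The jump in `overflowCost` is there so that the gain
is `θ` in both cases. -/
theorem overflowCost_le_of_le_div_add {θ ρ r η Z : ℝ} (hZ : 1 ≤ Z) (hη : 0 ≤ η) (hr : 1 < r)
    (hθ : θ = Real.log Z) (h : ρ ≤ r / Z + η) :
    overflowCost θ ρ ≤ overflowCost θ r - θ + Z * η := by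
  have hZ0 : 0 < Z := by linarith
  have h0 := Real.log_nonneg hr.le
  rw [overflowCost, overflowCost, if_pos hr]
  split_ifs with hρ
  · have h1 := log_le_log_add_of_le_add (by linarith) (div_pos (by linarith) hZ0) h
    rw [Real.log_div (by linarith) hZ0.ne', ← hθ] at h1
    have h2 : η / (r / Z) ≤ Z * η := by
      rw [div_div_eq_mul_div, mul_comm]
      exact div_le_self (by positivity) hr.le
    linarith
  · have : 0 ≤ Z * η := by positivity
    linarith

theorem abs_reconstruct_le {K : ℕ} {Δ : ℝ} (hΔ : 0 ≤ Δ) (c : Option (Fin K)) :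
    |reconstruct K Δ c| ≤ K / 2 * Δ := by
  rcases c with _ | k
  · simp only [reconstruct, abs_zero]
    positivity
  · have h1 : ((k : ℕ) : ℝ) + 1 ≤ K := by exact_mod_cast k.2
    have h0 : (0 : ℝ) ≤ (k : ℕ) := by positivity
    rw [reconstruct, abs_mul, abs_of_nonneg hΔ]
    gcongr
    rw [abs_le]
    constructor <;> linarith

theorem InBin.abs_sub_reconstruct_le {K : ℕ} {Δ x : ℝ} {k : Fin K} (hΔ : 0 ≤ Δ)
    (h : InBin K Δ k x) : |x - reconstruct K Δ (some k)| ≤ Δ / 2 := by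
  rw [reconstruct, abs_le]
  rcases h with ⟨h1, h2⟩ | ⟨h1, h2⟩
  · constructor <;> linarith
  · have h3 : ((k : ℕ) : ℝ) = K - 1 := eq_sub_of_add_eq (by exact_mod_cast h1)
    rw [h2, h3]
    constructor <;> linarith

/-- Lyapunov function of the adaptive quantizer, for bin sizes at least `s`. -/
noncomputable def lyapunov (K : ℕ) (s B θ x Δ : ℝ) : ℝ :=
  Real.log (Δ / s) + B * overflowCost θ (2 * |x| / (K * Δ))

theorem lyapunov_nonneg {K : ℕ} {s B θ x Δ : ℝ} (hs : 0 < s) (hB : 0 ≤ B) (hθ : 0 ≤ θ)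
    (hΔ : s ≤ Δ) : 0 ≤ lyapunov K s B θ x Δ :=
  add_nonneg (Real.log_nonneg ((one_le_div hs).2 hΔ)) (mul_nonneg hB (overflowCost_nonneg hθ _))

section Drift

variable {a α δ L : ℝ} {n K : ℕ}

/-- Zooming in happens only from bins of size at least `L`, and by a single factor `α ^ n`. -/
theorem le_mul_zoomFactor (ha : 1 ≤ |a|) (hα0 : 0 < α) (hδ : 0 < δ) (hL : 0 < L)
    {Δ : ℝ} (hΔ : α ^ n * L ≤ Δ) (c : Option (Fin K)) :
    α ^ n * L ≤ Δ * zoomFactor a α δ L n Δ c := by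
  have hβ : 0 < α ^ n := by positivity
  have hΔ0 : 0 < Δ := lt_of_lt_of_le (by positivity) hΔ
  rcases c with _ | k
  · exact hΔ.trans (le_mul_of_one_le_right hΔ0.le (one_le_pow₀ (by linarith)))
  · simp only [zoomFactor]
    split_ifs with h
    · rw [mul_comm]
      gcongr
    · simpa using hΔ

/-- One block of the closed loop decreases the Lyapunov function outside a bounded set, up to a
contribution of decoding errors and one of the noise. -/
theorem lyapunov_step_le {B θ : ℝ} (hK : 0 < K) (ha : 1 ≤ |a|) (hα0 : 0 < α) (hα1 : α < 1)
    (hδ : 0 < δ) (hL : 0 < L) (hB : 0 ≤ B) (hθ : θ = Real.log (((|a| + δ) / |a|) ^ n))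
    (hdrift : Real.log ((|a| + δ) ^ n) - B * θ ≤ Real.log (α ^ n))
    (hAK : 2 * |a| ^ n ≤ K * α ^ n) {x Δ w : ℝ} (c : Option (Fin K)) (hΔ : α ^ n * L ≤ Δ)
    (hout : ¬ (Δ ≤ L ∧ |x| ≤ K * L / 2)) :
    lyapunov K (α ^ n * L) B θ (a ^ n * (x - reconstruct K Δ c) + w)
        (Δ * zoomFactor a α δ L n Δ c) ≤
      lyapunov K (α ^ n * L) B θ x Δ + Real.log (α ^ n) +
        (if c = quantize K Δ x then 0 else
          Real.log ((|a| + δ) ^ n) + B * (Real.log (2 * |a| ^ n / α ^ n) + θ)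
            - Real.log (α ^ n)) +
        B * (1 + 2 * θ) * (2 / (K * (α ^ n * L))) * |w| := by
  have hβ : 0 < α ^ n := by positivity
  have hβ1 : α ^ n ≤ 1 := pow_le_one₀ hα0.le hα1.le
  have hA : 1 ≤ |a| ^ n := one_le_pow₀ ha
  have hD : 1 ≤ (|a| + δ) ^ n := one_le_pow₀ (by linarith)
  have hZ1 : 1 ≤ ((|a| + δ) / |a|) ^ n :=
    one_le_pow₀ ((one_le_div (by linarith)).2 (by linarith))
  have hθ0 : 0 ≤ θ := hθ ▸ Real.log_nonneg hZ1
  have hs : 0 < α ^ n * L := by positivity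
  have hΔ0 : 0 < Δ := hs.trans_le hΔ
  have hK0 : (0 : ℝ) < K := by exact_mod_cast hK
  have hΔ' := le_mul_zoomFactor (n := n) ha hα0 hδ hL hΔ c
  have hlogD := Real.log_nonneg hD
  have hlogβ := Real.log_nonpos hβ.le hβ1
  have hr1 : 1 ≤ 2 * |a| ^ n / α ^ n := (one_le_div hβ).2 (by linarith)
  have hlogr := Real.log_nonneg hr1
  set Z := zoomFactor a α δ L n Δ c with hZ
  have hZΔ : 0 < Δ * Z := hs.trans_le hΔ'
  have hZ0 : 0 < Z := pos_of_mul_pos_right hZΔ hΔ0.le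
  set e := reconstruct K Δ c with he
  have hec : |e| ≤ K / 2 * Δ := abs_reconstruct_le hΔ0.le c
  have hx' : |a ^ n * (x - e) + w| ≤ |a| ^ n * |x - e| + |w| := by
    rw [← abs_pow, ← abs_mul]
    exact abs_add_le _ _
  have hxe : |x - e| ≤ |x| + |e| := abs_sub _ _
  set η := 2 / (K * (α ^ n * L)) * |w| with hη
  have hη0 : 0 ≤ η := by positivity
  have hη' : 2 * |w| / (K * (Δ * Z)) ≤ η := by
    rw [hη, div_mul_eq_mul_div]
    gcongr
  set ρ := 2 * |x| / (K * Δ) with hρ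
  set ρ' := 2 * |a ^ n * (x - e) + w| / (K * (Δ * Z)) with hρ'
  have hbound : ∀ R : ℝ, |x - e| ≤ R →
      ρ' ≤ 2 * (|a| ^ n * R) / (K * (Δ * Z)) + 2 * |w| / (K * (Δ * Z)) := by
    intro R hR
    rw [← add_div, hρ']
    gcongr
    have : |a| ^ n * |x - e| ≤ |a| ^ n * R := by gcongr
    linarith
  have hlogΔ : Real.log (Δ * Z / (α ^ n * L)) = Real.log (Δ / (α ^ n * L)) + Real.log Z := by
    rw [mul_div_right_comm, Real.log_mul (by positivity) hZ0.ne']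
  have hexp : B * (1 + 2 * θ) * (2 / (K * (α ^ n * L))) * |w| = B * ((1 + 2 * θ) * η) := by
    rw [hη]
    ring
  have hηθ : η ≤ (1 + 2 * θ) * η := le_mul_of_one_le_left hη0 (by linarith)
  rw [lyapunov, lyapunov, hlogΔ, hexp, ← hρ, ← hρ']
  have hin : ρ ≤ 1 ↔ |x| ≤ K / 2 * Δ := by
    rw [hρ, div_le_one (by positivity)]
    constructor <;> intro h <;> linarith
  rcases le_or_gt ρ 1 with h1 | h1
  · have hxK := hin.1 h1
    -- A state in range but outside the rectangle has a bin larger than `L`, so any granular symbol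
    -- really zooms in.
    have hLΔ : L < Δ := by
      by_contra! hle
      refine hout ⟨hle, hxK.trans ?_⟩
      rw [div_mul_eq_mul_div]
      gcongr
    have hcost : overflowCost θ ρ = 0 := if_neg h1.not_gt
    rw [hcost]
    split_ifs with hc
    · rcases hq : quantize K Δ x with _ | k
      · exact absurd hxK (not_le.2 ((quantize_eq_none_iff hK hΔ0).1 hq))
      · rw [hq] at hc
        have hZβ : Z = α ^ n := by rw [hZ, hc, zoomFactor, if_pos hLΔ.le]
        have h2 := hbound (Δ / 2)
          (by rw [he, hc]; exact ((quantize_eq_some_iff hΔ0).1 hq).abs_sub_reconstruct_le hΔ0.le)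
        -- The quantization error is at most half a bin; `hAK` keeps its amplified size within half
        -- of the new range.
        have h3 : 2 * (|a| ^ n * (Δ / 2)) / (K * (Δ * Z)) ≤ 1 / 2 := by
          rw [div_le_iff₀ (by positivity), hZβ]
          nlinarith
        have h4 := overflowCost_le_of_le_half_add hθ0 hη0 (h2.trans (add_le_add h3 hη'))
        have h5 := mul_le_mul_of_nonneg_left h4 hB
        rw [hZβ]
        linarith
    -- Decoding error in range: state and estimate both lie in the range, hence differ by at most `K
    -- * Δ`. The error charge also contains `-Real.log (α ^ n)`, which cancels the decrease credited
    -- unconditionally.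
    · have hZβ : α ^ n ≤ Z ∧ Z ≤ (|a| + δ) ^ n := by
        rw [hZ]
        rcases c with _ | k
        · exact ⟨hβ1.trans hD, le_rfl⟩
        · rw [zoomFactor, if_pos hLΔ.le]
          exact ⟨le_rfl, hβ1.trans hD⟩
      have h2 := hbound (K * Δ) (by linarith)
      have h3 : 2 * (|a| ^ n * (K * Δ)) / (K * (Δ * Z)) ≤ 2 * |a| ^ n / α ^ n := by
        have : 2 * (|a| ^ n * (K * Δ)) / (K * (Δ * Z)) = 2 * |a| ^ n / Z := by
          field_simp
        rw [this]
        gcongr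
        exact hZβ.1
      have h4 := overflowCost_le_of_le_add hθ0 hη0 hr1 (h2.trans (add_le_add h3 hη'))
      have h5 := mul_le_mul_of_nonneg_left h4 hB
      have h6 := Real.log_le_log hZ0 hZβ.2
      have h7 := mul_le_mul_of_nonneg_left hηθ hB
      linarith
  · have hxK : K / 2 * Δ < |x| := not_le.1 fun h => h1.not_ge (hin.2 h)
    have hq := (quantize_eq_none_iff hK hΔ0).2 hxK
    rw [hq]
    split_ifs with hc
    · have hZD : Z = (|a| + δ) ^ n := by rw [hZ, hc, zoomFactor]
      have he0 : e = 0 := by rw [he, hc, reconstruct]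
      have h2 := hbound |x| (by rw [he0, sub_zero])
      have h3 : 2 * (|a| ^ n * |x|) / (K * (Δ * Z)) = ρ / ((|a| + δ) / |a|) ^ n := by
        have ha0 : |a| ^ n ≠ 0 := by positivity
        rw [hZD, hρ, div_pow]
        field_simp
      rw [h3] at h2
      have h4 := overflowCost_le_of_le_div_add hZ1 (by positivity) h1 hθ h2
      have h8 : ((|a| + δ) / |a|) ^ n * (2 * |w| / (K * (Δ * Z))) ≤ η := by
        have h9 : ((|a| + δ) / |a|) ^ n * (2 * |w| / (K * (Δ * Z))) =
            2 * |w| / (K * (|a| ^ n * Δ)) := by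
          rw [hZD, div_pow]
          field_simp
        rw [h9, hη, div_mul_eq_mul_div]
        exact div_le_div_of_nonneg_left (by positivity) (by positivity)
          (mul_le_mul_of_nonneg_left (hΔ.trans (le_mul_of_one_le_left hΔ0.le hA)) hK0.le)
      have h5 := mul_le_mul_of_nonneg_left (h4.trans (add_le_add_right h8 _)) hB
      have h7 := mul_le_mul_of_nonneg_left hηθ hB
      rw [hZD]
      linarith
    -- A missed overflow: the bin does not grow, and the wrong correction is smaller than `|x|`, so
    -- the error at most doubles the state.
    · have hZβ : α ^ n ≤ Z ∧ Z ≤ 1 := by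
        rw [hZ]
        rcases c with _ | k
        · exact absurd rfl hc
        · rw [zoomFactor]
          split_ifs
          · exact ⟨le_rfl, hβ1⟩
          · exact ⟨hβ1, le_rfl⟩
      have h2 := hbound (2 * |x|) (by linarith)
      have h3 : 2 * (|a| ^ n * (2 * |x|)) / (K * (Δ * Z)) ≤ 2 * |a| ^ n / α ^ n * ρ := by
        have : 2 * (|a| ^ n * (2 * |x|)) / (K * (Δ * Z)) = 2 * |a| ^ n / Z * ρ := by
          rw [hρ]
          field_simp
        rw [this]
        gcongr
        exact hZβ.1
      have h4 := overflowCost_le_of_le_add hθ0 hη0 (one_le_mul_of_one_le_of_one_le hr1 h1.le)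
        (h2.trans (add_le_add h3 hη'))
      rw [Real.log_mul (by positivity) (by positivity)] at h4
      have h10 : overflowCost θ ρ = Real.log ρ + θ := if_pos h1
      have h5 := mul_le_mul_of_nonneg_left h4 hB
      have h6 := Real.log_nonpos hZ0.le hZβ.2
      have h7 := mul_le_mul_of_nonneg_left hηθ hB
      have h8 := mul_nonneg hB hθ0
      rw [h10]
      linarith

end Drift

/-! ### Recurrence from drift. -/

/-- Foster's criterion: a process with negative drift outside a set visits it infinitely often. -/
theorem ae_frequently_mem_of_drift {Ω : Type*} [mΩ : MeasurableSpace Ω] (μ : Measure Ω)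
    [IsFiniteMeasure μ] (F : ℕ → MeasurableSpace Ω) (hF : Monotone F) (hle : ∀ k, F k ≤ mΩ)
    (S : ℕ → Set Ω) (hS : ∀ k, MeasurableSet[F k] (S k)) (V : ℕ → Ω → ℝ≥0∞)
    (hV : ∀ k, Measurable[F k] (V k)) (hfin : ∀ k ω, V k ω ≠ ∞) {c : ℝ≥0∞} (hc : c ≠ 0)
    (hdrift : ∀ k B, MeasurableSet[F k] B → Disjoint B (S k) →
      ∫⁻ ω in B, V (k + 1) ω ∂μ + c * μ B ≤ ∫⁻ ω in B, V k ω ∂μ) :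
    ∀ᵐ ω ∂μ, ∃ᶠ k in Filter.atTop, ω ∈ S k := by
  have key : ∀ k₀ N : ℕ, μ {ω | V k₀ ω ≤ N ∧ ∀ j, ω ∉ S (k₀ + j)} = 0 := by
    intro k₀ N
    set bad := {ω | V k₀ ω ≤ N ∧ ∀ j, ω ∉ S (k₀ + j)} with hbad
    -- The finite-horizon events `B i` are known at time `k₀ + i`, unlike `bad`. Each step on them
    -- loses at least `c * μ bad` from a budget of at most `N * μ univ`, which forces `μ bad = 0`.
    -- Starting from `V k₀ ≤ N` avoids any integrability assumption on `V`.
    set B : ℕ → Set Ω := fun i => {ω | V k₀ ω ≤ N ∧ ∀ j ≤ i, ω ∉ S (k₀ + j)} with hB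
    have hBF : ∀ i, MeasurableSet[F (k₀ + i)] (B i) := by
      intro i
      have h1 : B i = {ω | V k₀ ω ≤ N} ∩ ⋂ j, ⋂ _ : j ≤ i, (S (k₀ + j))ᶜ := by
        ext ω
        simp [hB]
      rw [h1]
      refine MeasurableSet.inter (hF (Nat.le_add_right _ _) _ (hV k₀ measurableSet_Iic)) ?_
      exact MeasurableSet.iInter fun j => MeasurableSet.iInter fun hj =>
        (hF (by omega) _ (hS (k₀ + j))).compl
    have hsub : ∀ i, bad ⊆ B i := fun i ω h => ⟨h.1, fun j _ => h.2 j⟩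
    have hanti : ∀ i, B (i + 1) ⊆ B i := fun i ω h => ⟨h.1, fun j hj => h.2 j (by omega)⟩
    have hind : ∀ i : ℕ, ∫⁻ ω in B i, V (k₀ + i) ω ∂μ + i * (c * μ bad) ≤ N * μ Set.univ := by
      intro i
      induction i with
      | zero =>
        simp only [add_zero, Nat.cast_zero, zero_mul]
        calc ∫⁻ ω in B 0, V k₀ ω ∂μ ≤ ∫⁻ ω in B 0, N ∂μ :=
              setLIntegral_mono' (hle _ _ (hBF 0)) fun ω h => h.1
          _ = N * μ (B 0) := by simp
          _ ≤ _ := by gcongr; exact Set.subset_univ _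
      | succ i ih =>
        refine le_trans ?_ ih
        calc ∫⁻ ω in B (i + 1), V (k₀ + (i + 1)) ω ∂μ + ((i + 1 : ℕ) : ℝ≥0∞) * (c * μ bad)
            ≤ ∫⁻ ω in B i, V (k₀ + i + 1) ω ∂μ + (c * μ (B i) + i * (c * μ bad)) := by
              push_cast
              rw [add_mul, one_mul, add_comm ((i : ℝ≥0∞) * _)]
              have h1 : μ bad ≤ μ (B i) := measure_mono (hsub i)
              exact add_le_add (lintegral_mono_set (hanti i)) (by gcongr)
          _ = (∫⁻ ω in B i, V (k₀ + i + 1) ω ∂μ + c * μ (B i)) + i * (c * μ bad) := by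
              rw [← add_assoc]
          _ ≤ _ := by
              gcongr
              exact hdrift _ _ (hBF i) (Set.disjoint_left.2 fun ω h => h.2 i le_rfl)
    by_contra h0
    obtain ⟨i, hi⟩ := ENNReal.exists_nat_mul_gt (a := c * μ bad) (b := N * μ Set.univ)
      (mul_ne_zero hc h0) (ENNReal.mul_ne_top (ENNReal.natCast_ne_top N) (measure_ne_top _ _))
    exact absurd (le_add_self.trans (hind i)) (not_le.2 hi)
  have hall : ∀ᵐ ω ∂μ, ∀ k₀ N : ℕ, ¬ (V k₀ ω ≤ N ∧ ∀ j, ω ∉ S (k₀ + j)) := by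
    rw [ae_all_iff]
    intro k₀
    rw [ae_all_iff]
    intro N
    rw [ae_iff]
    simpa using key k₀ N
  filter_upwards [hall] with ω hω
  rw [Filter.frequently_atTop]
  intro k₀
  obtain ⟨N, hN⟩ := ENNReal.exists_nat_gt (hfin k₀ ω)
  have h1 := hω k₀ N
  push Not at h1
  obtain ⟨j, hj⟩ := h1 hN.le
  exact ⟨k₀ + j, Nat.le_add_right _ _, hj⟩

theorem tsum_indicator_one_eq_top {E : Type*} {A : Set E} {Z : ℕ → E}
    (h : {m | Z m ∈ A}.Infinite) : ∑' m, A.indicator (fun _ => (1 : ℝ≥0∞)) (Z m) = ∞ := by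
  by_contra hne
  refine h ((ENNReal.finite_const_le_of_tsum_ne_top hne one_ne_zero).subset fun m hm => ?_)
  have hm' : Z m ∈ A := hm
  simp [hm']

/-! ### Measurability with respect to the past. -/

section History

variable {Ω Y : Type*} [MeasurableSpace Y]
  {x₀ : Ω → ℝ} {d : ℕ → Ω → ℝ} {q' : ℕ → Ω → Y}

theorem history_le [mΩ : MeasurableSpace Ω] (hx : Measurable x₀) (hd : ∀ t, Measurable (d t))
    (hq : ∀ t, Measurable (q' t)) (t : ℕ) : history x₀ d q' t ≤ mΩ :=
  sup_le hx.comap_le (iSup_le fun s => sup_le (hd s).comap_le (hq s).comap_le)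

theorem history_mono : Monotone (history x₀ d q') := by
  intro s t hst
  refine sup_le_sup le_rfl (iSup_le fun i => ?_)
  exact le_iSup (fun i : Fin t => MeasurableSpace.comap (d i) inferInstance ⊔
    MeasurableSpace.comap (q' i) inferInstance) (Fin.castLE hst i)

theorem measurable_history_init (t : ℕ) : Measurable[history x₀ d q' t] x₀ :=
  Measurable.mono (comap_measurable x₀) le_sup_left le_rfl

theorem measurable_history_noise {s t : ℕ} (hst : s < t) :
    Measurable[history x₀ d q' t] (d s) :=
  Measurable.mono (comap_measurable (d s)) (le_sup_of_le_right (le_trans le_sup_left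
    (le_iSup (fun i : Fin t => MeasurableSpace.comap (d i) inferInstance ⊔
    MeasurableSpace.comap (q' i) inferInstance) ⟨s, hst⟩))) le_rfl

theorem measurable_history_output {s t : ℕ} (hst : s < t) :
    Measurable[history x₀ d q' t] (q' s) :=
  Measurable.mono (comap_measurable (q' s)) (le_sup_of_le_right (le_trans le_sup_right
    (le_iSup (fun i : Fin t => MeasurableSpace.comap (d i) inferInstance ⊔
    MeasurableSpace.comap (q' i) inferInstance) ⟨s, hst⟩))) le_rfl

end History

theorem setLIntegral_eq_of_indep {Ω : Type*} {m₁ m₂ mΩ : MeasurableSpace Ω} {μ : Measure Ω}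
    (h₁ : m₁ ≤ mΩ) (h₂ : m₂ ≤ mΩ) (hind : Indep m₁ m₂ μ) {f : Ω → ℝ≥0∞} (hf : Measurable[m₁] f)
    {B : Set Ω} (hB : MeasurableSet[m₂] B) :
    ∫⁻ ω in B, f ω ∂μ = (∫⁻ ω, f ω ∂μ) * μ B := by
  have h := lintegral_mul_eq_lintegral_mul_lintegral_of_independent_measurableSpace h₁ h₂ hind hf
    (measurable_const.indicator hB : Measurable[m₂] (B.indicator fun _ => (1 : ℝ≥0∞)))
  rw [lintegral_indicator_const (h₂ _ hB), one_mul] at h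
  rw [← h, ← lintegral_indicator (h₂ _ hB)]
  refine lintegral_congr fun ω => ?_
  by_cases hω : ω ∈ B <;> simp [hω]

theorem measurable_overflowCost (θ : ℝ) : Measurable (overflowCost θ) := by
  unfold overflowCost
  exact Measurable.ite measurableSet_Ioi (Real.measurable_log.add_const θ) measurable_const

theorem Measurable.lyapunov {Ω : Type*} {m : MeasurableSpace Ω} {f g : Ω → ℝ} (K : ℕ)
    (s B θ : ℝ) (hf : Measurable f) (hg : Measurable g) :
    Measurable fun ω => _root_.lyapunov K s B θ (f ω) (g ω) := by
  unfold _root_.lyapunov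
  have h1 : Measurable fun ω => 2 * |f ω| / (K * g ω) :=
    ((measurable_abs.comp hf).const_mul 2).div (hg.const_mul _)
  exact (Real.measurable_log.comp (hg.div_const s)).add
    (((measurable_overflowCost θ).comp h1).const_mul B)

/-- Separates the finitely valued symbol from the bin size, for measurability. -/
theorem reconstruct_eq_mul (K : ℕ) (Δ : ℝ) (c : Option (Fin K)) :
    reconstruct K Δ c = reconstruct K 1 c * Δ := by
  rcases c with _ | k <;> simp [reconstruct]

theorem measurableSet_quantize_eq {Ω : Type*} {m : MeasurableSpace Ω} {f g : Ω → ℝ} {K : ℕ}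
    (hK : 0 < K) (hf : Measurable f) (hg : Measurable g) (hg0 : ∀ ω, 0 < g ω)
    (c : Option (Fin K)) : MeasurableSet {ω | quantize K (g ω) (f ω) = c} := by
  rcases c with _ | k
  · simp only [quantize_eq_none_iff hK (hg0 _)]
    exact measurableSet_lt (hg.const_mul _) (measurable_abs.comp hf)
  · simp only [quantize_eq_some_iff (hg0 _), InBin]
    exact ((measurableSet_le (hg.const_mul _) hf).inter
      (measurableSet_lt hf (hg.const_mul _))).union
      ((MeasurableSet.const _).inter (measurableSet_eq_fun hf (hg.const_mul _)))

/-- Measurability of a symbol-valued map is expressed by its fibres, so that no σ-algebra on the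
symbols enters the statements. -/
theorem measurable_comp_of_fibers {Ω ι β : Type*} {mΩ : MeasurableSpace Ω} [MeasurableSpace β]
    [Countable ι] {c : Ω → ι} (hc : ∀ i, MeasurableSet (c ⁻¹' {i})) (g : ι → β) :
    Measurable fun ω => g (c ω) := by
  let _ : MeasurableSpace ι := ⊤
  exact measurable_from_top.comp (measurable_to_countable' hc)

theorem Measurable.reconstruct {Ω : Type*} {mΩ : MeasurableSpace Ω} {K : ℕ} {f : Ω → ℝ}
    {c : Ω → Option (Fin K)} (hf : Measurable f) (hc : ∀ m, MeasurableSet (c ⁻¹' {m})) :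
    Measurable fun ω => _root_.reconstruct K (f ω) (c ω) := by
  simp only [reconstruct_eq_mul K (f _)]
  exact (measurable_comp_of_fibers hc (_root_.reconstruct K 1)).mul hf

theorem Measurable.zoomFactor {Ω : Type*} {mΩ : MeasurableSpace Ω} {K : ℕ} {f : Ω → ℝ}
    {c : Ω → Option (Fin K)} (hf : Measurable f) (hc : ∀ m, MeasurableSet (c ⁻¹' {m}))
    (a α δ L : ℝ) (n : ℕ) :
    Measurable fun ω => _root_.zoomFactor a α δ L n (f ω) (c ω) := by
  classical
  have heq : (fun ω => _root_.zoomFactor a α δ L n (f ω) (c ω)) = fun ω =>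
      if c ω = none then (|a| + δ) ^ n else if L ≤ f ω then α ^ n else 1 := by
    funext ω
    rcases c ω with _ | j <;> simp [_root_.zoomFactor]
  rw [heq]
  exact Measurable.ite (hc none) measurable_const (Measurable.ite
    (measurableSet_le measurable_const hf) measurable_const measurable_const)

theorem BlockCode.measurableSet_decoded {Ω X Y : Type*} {mΩ : MeasurableSpace Ω} [MeasurableSpace Y]
    [Fintype Y] [DiscreteMeasurableSpace Y] {n K : ℕ} (C : BlockCode X Y n K)
    {q' : ℕ → Ω → Y} {k : ℕ} (hq : ∀ i < n, Measurable (q' (k * n + i))) (m : Option (Fin K)) :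
    MeasurableSet (C.decoded q' k ⁻¹' {m}) :=
  (measurable_pi_lambda (fun ω (i : Fin n) => q' (k * n + i) ω) fun i => hq i i.2)
    (MeasurableSet.of_discrete (s := C.dec ⁻¹' {m}))

theorem BlockCode.measurableSet_history_decoded {Ω X Y : Type*} [MeasurableSpace Y] [Fintype Y]
    [DiscreteMeasurableSpace Y] {n K : ℕ} (C : BlockCode X Y n K) {x₀ : Ω → ℝ} {d : ℕ → Ω → ℝ}
    {q' : ℕ → Ω → Y} (k : ℕ) (m : Option (Fin K)) :
    MeasurableSet[history x₀ d q' ((k + 1) * n)] (C.decoded q' k ⁻¹' {m}) :=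
  C.measurableSet_decoded
    (fun i hi => measurable_history_output (by rw [add_mul, one_mul]; omega)) m

/-! ### The closed loop over one block: state, decoding errors, noise. -/

namespace IsClosedLoop

variable {Ω X Y : Type*} [mΩ : MeasurableSpace Ω] [MeasurableSpace Y] {μ : Measure Ω}
  {a b : ℝ} {v : ℝ≥0} {W : X → PMF Y} {α δ L : ℝ} {n K : ℕ} {C : BlockCode X Y n K} {Δ₀ : ℝ}
  {x d u Δ : ℕ → Ω → ℝ} {q : ℕ → Ω → X} {q' : ℕ → Ω → Y}

theorem history_le (h : IsClosedLoop μ a b v W α δ L C Δ₀ x d u Δ q q') (t : ℕ) :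
    history (x 0) d q' t ≤ mΩ :=
  _root_.history_le h.measurable_init h.measurable_noise h.measurable_output t

theorem le_bin (h : IsClosedLoop μ a b v W α δ L C Δ₀ x d u Δ q q') (ha : 1 ≤ |a|)
    (hα0 : 0 < α) (hα1 : α < 1) (hδ : 0 < δ) (hL : 0 < L) (hΔ₀ : L < Δ₀) (k : ℕ) (ω : Ω) :
    α ^ n * L ≤ Δ (k * n) ω := by
  induction k with
  | zero =>
    rw [zero_mul, h.bin_init]
    exact (mul_le_of_le_one_left hL.le (pow_le_one₀ hα0.le hα1.le)).trans hΔ₀.le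
  | succ k ih =>
    rw [h.bin_update]
    exact le_mul_zoomFactor ha hα0 hδ hL ih _

/-- The system runs freely until the last time of the block, where the control subtracts `a ^ n`
times the estimate. -/
theorem state_block (h : IsClosedLoop μ a b v W α δ L C Δ₀ x d u Δ q q') (hb : b ≠ 0)
    (hn : 0 < n) (k : ℕ) (ω : Ω) :
    x ((k + 1) * n) ω =
      a ^ n * (x (k * n) ω - reconstruct K (Δ (k * n) ω) (C.decoded q' k ω)) +
        ∑ i ∈ Finset.range n, a ^ (n - 1 - i) * d (k * n + i) ω := by
  have hstep : ∀ j < n, x (k * n + j) ω = a ^ j * x (k * n) ω +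
      ∑ i ∈ Finset.range j, a ^ (j - 1 - i) * d (k * n + i) ω := by
    intro j
    induction j with
    | zero => simp
    | succ j ih =>
      intro hj
      have hu : u (k * n + j) ω = 0 := by
        rw [h.control_eq, if_neg]
        rw [add_assoc, Nat.dvd_add_right (dvd_mul_left n k)]
        exact Nat.not_dvd_of_pos_of_lt (Nat.succ_pos j) hj
      rw [← add_assoc, h.state_eq, ih (by omega), hu, Finset.sum_range_succ, mul_add, mul_zero,
        add_zero, Finset.mul_sum, ← mul_assoc, ← pow_succ', add_assoc]
      congr 2
      · refine Finset.sum_congr rfl fun i hi => ?_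
        rw [Finset.mem_range] at hi
        rw [← mul_assoc, ← pow_succ']
        congr 2
        omega
      · simp
  obtain ⟨N, rfl⟩ : ∃ N, n = N + 1 := ⟨n - 1, by omega⟩
  have hdiv : (k * (N + 1) + N) / (N + 1) = k := by
    rw [mul_comm, Nat.mul_add_div (Nat.succ_pos N), Nat.div_eq_of_lt (Nat.lt_succ_self N), add_zero]
  have hu : u (k * (N + 1) + N) ω = -(a ^ (N + 1) / b) *
      reconstruct K (Δ (k * (N + 1)) ω) (C.decoded q' k ω) := by
    rw [h.control_eq, if_pos ⟨k + 1, by ring⟩, hdiv]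
  rw [show (k + 1) * (N + 1) = k * (N + 1) + N + 1 by ring, h.state_eq,
    hstep N (Nat.lt_succ_self N), hu, Finset.sum_range_succ, mul_add a, Finset.mul_sum]
  have hsum : ∑ i ∈ Finset.range N, a * (a ^ (N - 1 - i) * d (k * (N + 1) + i) ω) =
      ∑ i ∈ Finset.range N, a ^ (N + 1 - 1 - i) * d (k * (N + 1) + i) ω := by
    refine Finset.sum_congr rfl fun i hi => ?_
    rw [Finset.mem_range] at hi
    rw [← mul_assoc, ← pow_succ']
    congr 2
    omega
  rw [hsum]
  simp only [add_tsub_cancel_right, tsub_self, pow_zero, one_mul]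
  field_simp
  ring

theorem measurable_bin [Fintype Y] [DiscreteMeasurableSpace Y]
    (h : IsClosedLoop μ a b v W α δ L C Δ₀ x d u Δ q q') (k : ℕ) :
    Measurable[history (x 0) d q' (k * n)] (Δ (k * n)) := by
  induction k with
  | zero =>
    rw [zero_mul, show Δ 0 = fun _ => Δ₀ from funext h.bin_init]
    exact measurable_const
  | succ k ih =>
    have ih' : Measurable[history (x 0) d q' ((k + 1) * n)] (Δ (k * n)) :=
      ih.mono (history_mono (by gcongr; omega)) le_rfl
    rw [show Δ ((k + 1) * n) = _ from funext (h.bin_update k)]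
    exact ih'.mul (Measurable.zoomFactor ih' (C.measurableSet_history_decoded k) _ _ _ _ _)

theorem measurable_state [Fintype Y] [DiscreteMeasurableSpace Y]
    (h : IsClosedLoop μ a b v W α δ L C Δ₀ x d u Δ q q') (hb : b ≠ 0) (hn : 0 < n) (k : ℕ) :
    Measurable[history (x 0) d q' (k * n)] (x (k * n)) := by
  induction k with
  | zero =>
    rw [zero_mul]
    exact measurable_history_init 0
  | succ k ih =>
    have hle : history (x 0) d q' (k * n) ≤ history (x 0) d q' ((k + 1) * n) :=
      history_mono (by gcongr; omega)
    have hx := ih.mono hle le_rfl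
    have hΔ := (h.measurable_bin k).mono hle le_rfl
    rw [show x ((k + 1) * n) = _ from funext (h.state_block hb hn k)]
    refine Measurable.add (Measurable.const_mul (hx.sub
      (Measurable.reconstruct hΔ (C.measurableSet_history_decoded k))) _) ?_
    refine Finset.measurable_fun_sum _ fun i hi => Measurable.const_mul ?_ _
    refine measurable_history_noise ?_
    rw [Finset.mem_range] at hi
    rw [add_mul, one_mul]
    omega

/-- Once the inputs are frozen on `B`, the outputs behave like independent uses of the channel:
condition on `history` at each time in turn and integrate `channel_law`. -/
theorem measureReal_inter_outputs [IsProbabilityMeasure μ] [DiscreteMeasurableSpace Y]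
    (h : IsClosedLoop μ a b v W α δ L C Δ₀ x d u Δ q q') (t : ℕ) {B : Set Ω}
    (hB : MeasurableSet[history (x 0) d q' t] B) {N : ℕ} (e : Fin N → X) (y : Fin N → Y)
    (hq : ∀ ω ∈ B, ∀ i : Fin N, q (t + i) ω = e i) :
    μ.real (B ∩ {ω | ∀ i : Fin N, q' (t + i) ω = y i}) =
      μ.real B * ∏ i, (W (e i) (y i)).toReal := by
  induction N with
  | zero => simp
  | succ N ih =>
    have ih' := ih (fun i => e i.castSucc) (fun i => y i.castSucc)
      (fun ω hω i => hq ω hω i.castSucc)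
    set B' := B ∩ {ω | ∀ i : Fin N, q' (t + i) ω = y i.castSucc} with hB'
    have hset : B ∩ {ω | ∀ i : Fin (N + 1), q' (t + i) ω = y i} =
        B' ∩ q' (t + N) ⁻¹' {y (Fin.last N)} := by
      ext ω
      simp [hB', Fin.forall_fin_succ', and_assoc]
    have hBm : MeasurableSet[history (x 0) d q' (t + N)] B' := by
      refine MeasurableSet.inter (history_mono (Nat.le_add_right t N) _ hB) ?_
      rw [Set.ofPred_forall]
      exact MeasurableSet.iInter fun i =>
        measurable_history_output (by have := i.2; omega) (measurableSet_singleton _)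
    have hle := h.history_le (t + N)
    have hout : MeasurableSet (q' (t + N) ⁻¹' {y (Fin.last N)}) :=
      h.measurable_output _ (measurableSet_singleton _)
    have h1 := setIntegral_condExp hle (μ := μ)
      (f := (q' (t + N) ⁻¹' {y (Fin.last N)}).indicator fun _ => (1 : ℝ))
      ((integrable_const _).indicator hout) hBm
    rw [setIntegral_indicator hout, setIntegral_const, smul_eq_mul, mul_one] at h1
    rw [hset, ← h1, Fin.prod_univ_castSucc, ← mul_assoc, ← ih',
      setIntegral_congr_ae (g := fun _ => (W (e (Fin.last N)) (y (Fin.last N))).toReal)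
        (hle _ hBm)]
    · rw [setIntegral_const, smul_eq_mul]
    · filter_upwards [h.channel_law (t + N) (y (Fin.last N))] with ω hω hωB
      rw [hω]
      have := hq ω hωB.1 (Fin.last N)
      rw [Fin.val_last] at this
      rw [this]

/-- Split `B` according to the transmitted symbol; on each piece the codeword is fixed. The symbol
may have any law given the past, which is why the maximal rather than the average error of the code
is needed. -/
theorem measureReal_decoded_ne_le [IsProbabilityMeasure μ] [Fintype Y]
    [DiscreteMeasurableSpace Y]
    (h : IsClosedLoop μ a b v W α δ L C Δ₀ x d u Δ q q') (hb : b ≠ 0) (hn : 0 < n) (hK : 0 < K)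
    (hΔ : ∀ k ω, 0 < Δ (k * n) ω) {ε : ℝ}
    (hε : ∀ m, ∑ y with C.dec y ≠ m, ∏ i, (W (C.enc m i) (y i)).toReal ≤ ε) (k : ℕ)
    {B : Set Ω} (hB : MeasurableSet[history (x 0) d q' (k * n)] B) :
    μ.real (B ∩ {ω | C.decoded q' k ω ≠ quantize K (Δ (k * n) ω) (x (k * n) ω)}) ≤
      ε * μ.real B := by
  set s : Ω → Option (Fin K) := fun ω => quantize K (Δ (k * n) ω) (x (k * n) ω) with hs
  have hsm : ∀ m, MeasurableSet[history (x 0) d q' (k * n)] {ω | s ω = m} := fun m =>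
    measurableSet_quantize_eq hK (h.measurable_state hb hn k) (h.measurable_bin k) (hΔ k) m
  have hle := h.history_le (k * n)
  have hBm : ∀ m, μ.real (B ∩ {ω | s ω = m} ∩ {ω | C.decoded q' k ω ≠ m}) ≤
      ε * μ.real (B ∩ {ω | s ω = m}) := by
    intro m
    have hsub : B ∩ {ω | s ω = m} ∩ {ω | C.decoded q' k ω ≠ m} ⊆
        ⋃ y ∈ Finset.univ.filter fun y => C.dec y ≠ m,
          (B ∩ {ω | s ω = m} ∩ {ω | ∀ i : Fin n, q' (k * n + i) ω = y i}) := by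
      rintro ω ⟨h1, h2⟩
      simp only [Set.mem_iUnion, Finset.mem_filter, Finset.mem_univ, true_and]
      exact ⟨fun i => q' (k * n + i) ω, h2, h1, fun i => rfl⟩
    calc _ ≤ _ := measureReal_mono hsub (measure_ne_top _ _)
      _ ≤ ∑ y with C.dec y ≠ m, _ := measureReal_biUnion_finset_le _ _
      _ = ∑ y with C.dec y ≠ m, μ.real (B ∩ {ω | s ω = m}) *
            ∏ i, (W (C.enc m i) (y i)).toReal := by
          refine Finset.sum_congr rfl fun y _ => ?_
          refine h.measureReal_inter_outputs (k * n) (hB.inter (hsm m)) (C.enc m) y ?_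
          intro ω hω i
          rw [h.input_eq]
          have : s ω = m := hω.2
          rw [← this]
      _ ≤ ε * μ.real (B ∩ {ω | s ω = m}) := by
          rw [← Finset.mul_sum, mul_comm]
          gcongr
          exact hε m
  have hsub : B ∩ {ω | C.decoded q' k ω ≠ s ω} ⊆
      ⋃ m ∈ (Finset.univ : Finset (Option (Fin K))),
        (B ∩ {ω | s ω = m} ∩ {ω | C.decoded q' k ω ≠ m}) := by
    rintro ω ⟨h1, h2⟩
    simp only [Set.mem_iUnion, Finset.mem_univ]
    exact ⟨s ω, trivial, ⟨h1, rfl⟩, h2⟩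
  have hBU : ⋃ m ∈ (Finset.univ : Finset (Option (Fin K))), (B ∩ {ω | s ω = m}) = B := by
    ext ω
    simp
  calc _ ≤ _ := measureReal_mono hsub (measure_ne_top _ _)
    _ ≤ _ := measureReal_biUnion_finset_le _ _
    _ ≤ ∑ m, ε * μ.real (B ∩ {ω | s ω = m}) := Finset.sum_le_sum fun m _ => hBm m
    _ = ε * μ.real B := by
        rw [← Finset.mul_sum, ← measureReal_biUnion_finset, hBU]
        · intro m _ m' _ hmm
          refine Set.disjoint_left.2 fun ω h1 h2 => hmm ?_
          exact h1.2.symm.trans h2.2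
        · exact fun m _ => (hle _ hB).inter (hle _ (hsm m))

theorem setLIntegral_noise (h : IsClosedLoop μ a b v W α δ L C Δ₀ x d u Δ q q') {s t : ℕ}
    (hst : s ≤ t) {B : Set Ω} (hB : MeasurableSet[history (x 0) d q' s] B) :
    ∫⁻ ω in B, ENNReal.ofReal |d t ω| ∂μ =
      ENNReal.ofReal (∫ z, |z| ∂gaussianReal 0 v) * μ B := by
  have hsup : history (x 0) d q' t ⊔ MeasurableSpace.comap (q' t) inferInstance ≤ mΩ :=
    sup_le (h.history_le t) (h.measurable_output t).comap_le
  rw [setLIntegral_eq_of_indep (f := fun ω => ENNReal.ofReal |d t ω|)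
    (h.measurable_noise t).comap_le hsup (h.noise_indep t)
    (ENNReal.measurable_ofReal.comp (measurable_abs.comp (comap_measurable (d t))))
    ((history_mono hst).trans le_sup_left _ hB)]
  congr 1
  have hint : Integrable (fun z : ℝ => |z|) (gaussianReal 0 v) :=
    ((memLp_id_gaussianReal (μ := 0) (v := v) 1).integrable (by simp)).abs
  rw [ofReal_integral_eq_lintegral_ofReal hint (Filter.Eventually.of_forall fun z => abs_nonneg z),
    ← h.noise_law t, lintegral_map (by fun_prop) (h.measurable_noise t)]

end IsClosedLoop

theorem abs_sum_pow_mul_le {a : ℝ} (ha : 1 ≤ |a|) (n : ℕ) (f : ℕ → ℝ) :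
    |∑ i ∈ Finset.range n, a ^ (n - 1 - i) * f i| ≤
      |a| ^ n * ∑ i ∈ Finset.range n, |f i| := by
  refine (Finset.abs_sum_le_sum_abs _ _).trans ?_
  rw [Finset.mul_sum]
  refine Finset.sum_le_sum fun i _ => ?_
  rw [abs_mul, abs_pow]
  gcongr
  omega

/-! ### Recurrence of the closed loop. -/

namespace IsClosedLoop

variable {Ω X Y : Type*} [mΩ : MeasurableSpace Ω] [MeasurableSpace Y] {μ : Measure Ω}
  {a b : ℝ} {v : ℝ≥0} {W : X → PMF Y} {α δ L : ℝ} {n K : ℕ} {C : BlockCode X Y n K} {Δ₀ : ℝ}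
  {x d u Δ : ℕ → Ω → ℝ} {q : ℕ → Ω → X} {q' : ℕ → Ω → Y}

theorem setLIntegral_sum_noise (h : IsClosedLoop μ a b v W α δ L C Δ₀ x d u Δ q q') (k : ℕ)
    {B : Set Ω} (hB : MeasurableSet[history (x 0) d q' (k * n)] B) :
    ∫⁻ ω in B, ENNReal.ofReal (∑ i ∈ Finset.range n, |d (k * n + i) ω|) ∂μ =
      ENNReal.ofReal (n * ∫ z, |z| ∂gaussianReal 0 v) * μ B := by
  simp only [ENNReal.ofReal_sum_of_nonneg fun i _ => abs_nonneg (d (k * n + i) _)]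
  have hm : ∀ i, Measurable fun ω => ENNReal.ofReal |d (k * n + i) ω| := fun i =>
    ENNReal.measurable_ofReal.comp (measurable_abs.comp (h.measurable_noise _))
  rw [lintegral_finsetSum _ fun i _ => hm i]
  rw [Finset.sum_congr rfl fun i _ => h.setLIntegral_noise (Nat.le_add_right (k * n) i) hB]
  rw [Finset.sum_const, Finset.card_range, nsmul_eq_mul, ENNReal.ofReal_mul (Nat.cast_nonneg n),
    ENNReal.ofReal_natCast, mul_assoc]

/-- The closed loop returns infinitely often to a fixed rectangle, when decoding errors are
unlikely and the noise is small compared with the range of the quantizer. -/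
theorem isCoordinateRecurrent [IsProbabilityMeasure μ] [Fintype Y] [DiscreteMeasurableSpace Y]
    (h : IsClosedLoop μ a b v W α δ L C Δ₀ x d u Δ q q') (hb : b ≠ 0) (hn : 0 < n) (hK : 0 < K)
    (ha : 1 ≤ |a|) (hα0 : 0 < α) (hα1 : α < 1) (hδ : 0 < δ) (hL : 0 < L) (hΔ₀ : L < Δ₀)
    {B θ ε : ℝ} (hB : 0 ≤ B) (hθ : θ = Real.log (((|a| + δ) / |a|) ^ n))
    (hdrift : Real.log ((|a| + δ) ^ n) - B * θ ≤ Real.log (α ^ n))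
    (hAK : 2 * |a| ^ n ≤ K * α ^ n)
    (hε : ∀ m, ∑ y with C.dec y ≠ m, ∏ i, (W (C.enc m i) (y i)).toReal ≤ ε) (hε0 : 0 ≤ ε)
    (herr : (Real.log ((|a| + δ) ^ n) + B * (Real.log (2 * |a| ^ n / α ^ n) + θ)
      - Real.log (α ^ n)) * ε ≤ -Real.log (α ^ n) / 4)
    (hnoise : B * (1 + 2 * θ) * (2 / (K * (α ^ n * L))) *
      (|a| ^ n * (n * ∫ z, |z| ∂gaussianReal 0 v)) ≤ -Real.log (α ^ n) / 4) :
    IsCoordinateRecurrent μ (fun t ω => (x t ω, Δ t ω))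
        (Set.Icc (-(K * L / 2)) (K * L / 2) ×ˢ Set.Icc (α ^ n * L) L) ∧
      IsCoordinateRecurrent μ (fun k ω => (x (k * n) ω, Δ (k * n) ω))
        (Set.Icc (-(K * L / 2)) (K * L / 2) ×ˢ Set.Icc (α ^ n * L) L) := by
  set A : Set (ℝ × ℝ) := Set.Icc (-(K * L / 2)) (K * L / 2) ×ˢ Set.Icc (α ^ n * L) L with hA
  have hAm : MeasurableSet A := measurableSet_Icc.prod measurableSet_Icc
  have hbin := h.le_bin ha hα0 hα1 hδ hL hΔ₀
  have hs : 0 < α ^ n * L := by positivity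
  have hK0 : (0 : ℝ) < K := by exact_mod_cast hK
  have hβ : 0 < α ^ n := by positivity
  have hβ1 : α ^ n < 1 := pow_lt_one₀ hα0.le hα1 hn.ne'
  have hZ1 : 1 ≤ ((|a| + δ) / |a|) ^ n :=
    one_le_pow₀ ((one_le_div (by linarith)).2 (by linarith))
  have hθ0 : 0 ≤ θ := hθ ▸ Real.log_nonneg hZ1
  set c₀ := -Real.log (α ^ n) with hc₀
  have hc₀pos : 0 < c₀ := neg_pos.2 (Real.log_neg hβ hβ1)
  set F := Real.log ((|a| + δ) ^ n) + B * (Real.log (2 * |a| ^ n / α ^ n) + θ)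
      - Real.log (α ^ n) with hF
  have hF0 : 0 ≤ F := by
    have h1 : 0 ≤ Real.log ((|a| + δ) ^ n) := Real.log_nonneg (one_le_pow₀ (by linarith))
    have h2 : 0 ≤ Real.log (2 * |a| ^ n / α ^ n) := by
      refine Real.log_nonneg ((one_le_div hβ).2 ?_)
      have := one_le_pow₀ ha (n := n)
      linarith
    have h3 : 0 ≤ B * (Real.log (2 * |a| ^ n / α ^ n) + θ) := by positivity
    rw [hF]
    linarith
  set G := B * (1 + 2 * θ) * (2 / (K * (α ^ n * L))) with hG
  have hG0 : 0 ≤ G := by positivity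
  set V : ℕ → Ω → ℝ := fun k ω => lyapunov K (α ^ n * L) B θ (x (k * n) ω) (Δ (k * n) ω) with hV
  have hV0 : ∀ k ω, 0 ≤ V k ω := fun k ω => lyapunov_nonneg hs hB hθ0 (hbin k ω)
  have hVm : ∀ k, Measurable[history (x 0) d q' (k * n)] (V k) := fun k =>
    (h.measurable_state hb hn k).lyapunov K _ B θ (h.measurable_bin k)
  set err : ℕ → Set Ω :=
    fun k => {ω | C.decoded q' k ω ≠ quantize K (Δ (k * n) ω) (x (k * n) ω)} with herrdef
  set noise : ℕ → Ω → ℝ := fun k ω => ∑ i ∈ Finset.range n, |d (k * n + i) ω| with hnoisedef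
  have hnoise0 : ∀ k ω, 0 ≤ noise k ω := fun k ω => Finset.sum_nonneg fun i _ => abs_nonneg _
  -- The pathwise drift inequality; integrating it over events of the past turns the error and noise
  -- terms into at most `c₀ / 4` each.
  have hstep : ∀ k ω, (x (k * n) ω, Δ (k * n) ω) ∉ A →
      V (k + 1) ω + c₀ ≤ V k ω + (err k).indicator (fun _ => F) ω + G * |a| ^ n * noise k ω := by
    intro k ω hω
    have hout : ¬ (Δ (k * n) ω ≤ L ∧ |x (k * n) ω| ≤ K * L / 2) := fun hc =>
      hω ⟨abs_le.1 hc.2, hbin k ω, hc.1⟩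
    have h1 := lyapunov_step_le (a := a)
      (w := ∑ i ∈ Finset.range n, a ^ (n - 1 - i) * d (k * n + i) ω)
      hK ha hα0 hα1 hδ hL hB hθ hdrift hAK (C.decoded q' k ω) (hbin k ω) hout
    rw [← h.state_block hb hn, ← h.bin_update] at h1
    have h2 : (if C.decoded q' k ω = quantize K (Δ (k * n) ω) (x (k * n) ω) then 0 else F) =
        (err k).indicator (fun _ => F) ω := by
      by_cases hc : C.decoded q' k ω = quantize K (Δ (k * n) ω) (x (k * n) ω) <;>
        simp [herrdef, hc]
    rw [h2] at h1
    have h3 := mul_le_mul_of_nonneg_left (abs_sum_pow_mul_le ha n fun i => d (k * n + i) ω) hG0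
    rw [← mul_assoc] at h3
    simp only [hV]
    linarith
  have hrec : ∀ᵐ ω ∂μ, ∃ᶠ k in Filter.atTop, ω ∈ {ω | (x (k * n) ω, Δ (k * n) ω) ∈ A} := by
    refine ae_frequently_mem_of_drift μ (fun k => history (x 0) d q' (k * n))
      (fun i j hij => history_mono (Nat.mul_le_mul_right n hij)) (fun k => h.history_le _)
      (fun k => {ω | (x (k * n) ω, Δ (k * n) ω) ∈ A})
      (fun k => (h.measurable_state hb hn k).prodMk (h.measurable_bin k) hAm)
      (fun k ω => ENNReal.ofReal (V k ω))
      (fun k => ENNReal.measurable_ofReal.comp (hVm k)) (fun k ω => ENNReal.ofReal_ne_top)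
      (c := ENNReal.ofReal (c₀ / 2)) (by simpa using hc₀pos) ?_
    intro k D hD hdisj
    have hDm : MeasurableSet D := h.history_le _ _ hD
    have hVm' : ∀ k, Measurable (V k) := fun k => (hVm k).mono (h.history_le _) le_rfl
    have herrm : MeasurableSet (err k) := by
      have : err k = ⋃ m : Option (Fin K),
          {ω | quantize K (Δ (k * n) ω) (x (k * n) ω) = m} ∩ (C.decoded q' k ⁻¹' {m})ᶜ := by
        ext ω
        simp [herrdef]
      rw [this]
      exact MeasurableSet.iUnion fun m => (h.history_le (k * n) _ (measurableSet_quantize_eq hK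
        (h.measurable_state hb hn k) (h.measurable_bin k) (fun ω => hs.trans_le (hbin k ω)) m)).inter
        (C.measurableSet_decoded (fun i _ => h.measurable_output _) m).compl
    have herrle : μ (D ∩ err k) ≤ ENNReal.ofReal ε * μ D := by
      have h1 := h.measureReal_decoded_ne_le hb hn hK (fun k ω => hs.trans_le (hbin k ω)) hε k hD
      have h2 := ENNReal.ofReal_le_ofReal h1
      rwa [ENNReal.ofReal_mul hε0, ofReal_measureReal, ofReal_measureReal] at h2
    have hpt : ∫⁻ ω in D, (ENNReal.ofReal (V (k + 1) ω) + ENNReal.ofReal c₀) ∂μ ≤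
        ∫⁻ ω in D, (ENNReal.ofReal (V k ω) +
          (err k).indicator (fun _ => ENNReal.ofReal F) ω +
          ENNReal.ofReal (G * |a| ^ n) * ENNReal.ofReal (noise k ω)) ∂μ := by
      refine setLIntegral_mono' hDm fun ω hω => ?_
      have h1 := hstep k ω (Set.disjoint_left.1 hdisj hω)
      have h2 : (err k).indicator (fun _ => ENNReal.ofReal F) ω =
          ENNReal.ofReal ((err k).indicator (fun _ => F) ω) := by
        by_cases hc : ω ∈ err k <;> simp [hc]
      have h3 : 0 ≤ (err k).indicator (fun _ => F) ω := Set.indicator_nonneg (fun _ _ => hF0) ω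
      rw [h2, ← ENNReal.ofReal_mul (by positivity), ← ENNReal.ofReal_add (hV0 _ _) hc₀pos.le,
        ← ENNReal.ofReal_add (hV0 _ _) h3, ← ENNReal.ofReal_add (add_nonneg (hV0 _ _) h3)
          (mul_nonneg (by positivity) (hnoise0 k ω))]
      exact ENNReal.ofReal_le_ofReal h1
    have hVk : Measurable fun ω => ENNReal.ofReal (V k ω) :=
      ENNReal.measurable_ofReal.comp (hVm' k)
    have hVe : Measurable fun ω => ENNReal.ofReal (V k ω) +
        (err k).indicator (fun _ => ENNReal.ofReal F) ω :=
      hVk.add (measurable_const.indicator herrm)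
    rw [lintegral_add_right _ measurable_const, setLIntegral_const, lintegral_add_left hVe,
      lintegral_add_left hVk,
      lintegral_indicator_const herrm, Measure.restrict_apply herrm, Set.inter_comm,
      lintegral_const_mul' _ _ ENNReal.ofReal_ne_top, h.setLIntegral_sum_noise k hD] at hpt
    have h4 : ENNReal.ofReal F * μ (D ∩ err k) ≤ ENNReal.ofReal (c₀ / 4) * μ D := by
      calc _ ≤ ENNReal.ofReal F * (ENNReal.ofReal ε * μ D) := by gcongr
        _ = ENNReal.ofReal (F * ε) * μ D := by rw [ENNReal.ofReal_mul hF0, mul_assoc]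
        _ ≤ _ := by gcongr
    have h5 : ENNReal.ofReal (G * |a| ^ n) *
        (ENNReal.ofReal (n * ∫ z, |z| ∂gaussianReal 0 v) * μ D) ≤
        ENNReal.ofReal (c₀ / 4) * μ D := by
      rw [← mul_assoc, ← ENNReal.ofReal_mul (by positivity), mul_assoc]
      gcongr
    have h6 : ENNReal.ofReal (c₀ / 4) * μ D + ENNReal.ofReal (c₀ / 4) * μ D =
        ENNReal.ofReal (c₀ / 2) * μ D := by
      rw [← add_mul, ← ENNReal.ofReal_add (by positivity) (by positivity)]
      ring_nf
    have h7 : ENNReal.ofReal c₀ * μ D =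
        ENNReal.ofReal (c₀ / 2) * μ D + ENNReal.ofReal (c₀ / 2) * μ D := by
      rw [← add_mul, ← ENNReal.ofReal_add (by positivity) (by positivity), add_halves]
    have h8 := hpt.trans (add_le_add (add_le_add_right h4 _) h5)
    rw [add_assoc, h6, h7, ← add_assoc] at h8
    -- Only the finite term `c₀ / 2 * μ D` is cancelled, so the integrals of `V` need not be known
    -- to be finite.
    exact (ENNReal.add_le_add_iff_right
      (ENNReal.mul_ne_top ENNReal.ofReal_ne_top (measure_ne_top μ D))).1 h8
  have hinf : ∀ᵐ ω ∂μ, {k | (x (k * n) ω, Δ (k * n) ω) ∈ A}.Infinite := by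
    filter_upwards [hrec] with ω hω
    exact Nat.frequently_atTop_iff_infinite.1 hω
  refine ⟨⟨hAm, ?_⟩, hAm, ?_⟩
  · filter_upwards [hinf] with ω hω
    refine tsum_indicator_one_eq_top ?_
    -- Visits at distinct block ends are visits at distinct times, as `n > 0`.
    refine (hω.image (f := fun k => k * n) fun i _ j _ hij =>
      Nat.eq_of_mul_eq_mul_right hn hij).mono ?_
    rintro _ ⟨k, hk, rfl⟩
    exact hk
  · filter_upwards [hinf] with ω hω
    exact tsum_indicator_one_eq_top hω

end IsClosedLoop

/-! ### Choice of the parameters. -/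

theorem mainTheorem4 {X Y : Type*} [Fintype X] [Fintype Y]
    [MeasurableSpace Y] [DiscreteMeasurableSpace Y]
    (W : X → PMF Y) (a b : ℝ) (v : ℝ≥0) (ha : 1 ≤ |a|) (hb : b ≠ 0)
    (hC : Real.logb 2 |a| < capacity W) :
    ∃ α₀ : ℝ, 0 < α₀ ∧ α₀ < 1 ∧
      ∀ α : ℝ, α₀ ≤ α → α < 1 → ∀ δ : ℝ, 0 < δ → ∀ L : ℝ, 0 < L →
        ∃ n₀ : ℕ, ∀ n : ℕ, n₀ ≤ n → 0 < n →
          ∃ (K : ℕ) (C : BlockCode X Y n K) (A : Set (ℝ × ℝ)),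
            Even K ∧ 2 ≤ K ∧ ⌈|a| ^ n⌉₊ < K ∧
            n * Real.logb 2 (|a| / α) < Real.logb 2 K ∧
            IsCompact A ∧ (∀ p ∈ A, 0 < p.2) ∧
            ∀ {Ω : Type*} [MeasurableSpace Ω] (μ : Measure Ω) [IsProbabilityMeasure μ]
              (Δ₀ : ℝ) (x d u Δ : ℕ → Ω → ℝ) (q : ℕ → Ω → X) (q' : ℕ → Ω → Y),
              L < Δ₀ →
              IsClosedLoop μ a b v W α δ L C Δ₀ x d u Δ q q' →
                IsCoordinateRecurrent μ (fun t ω => (x t ω, Δ t ω)) A ∧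
                IsCoordinateRecurrent μ (fun k ω => (x (k * n) ω, Δ (k * n) ω)) A := by
  obtain ⟨l, hl1, hl2⟩ := exists_between hC
  have ha0 : 0 < |a| := by linarith
  set T : ℝ := 2 ^ l with hT
  have haT : |a| < T := (Real.logb_lt_iff_lt_rpow (by norm_num) ha0).1 hl1
  have hTC : Real.logb 2 T < capacity W := by
    rwa [hT, Real.logb_rpow (by norm_num) (by norm_num)]
  -- Two rates with `|a| < S < T`: `S` bounds `|a| / α` through `α₀ = |a| / S`, and `T`, below
  -- capacity, is the rate of the quantizer. The gap between them absorbs the noise.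
  obtain ⟨S, haS, hST⟩ := exists_between haT
  have hS0 : 0 < S := ha0.trans haS
  have hT0 : 0 < T := hS0.trans hST
  refine ⟨|a| / S, div_pos ha0 hS0, (div_lt_one hS0).2 haS, fun α hα hα1 δ hδ L hL => ?_⟩
  have hα0 : 0 < α := (div_pos ha0 hS0).trans_le hα
  have haα : |a| / α ≤ S := by
    rw [div_le_iff₀ hS0] at hα
    rw [div_le_iff₀ hα0]
    linarith
  set κ := Real.log ((|a| + δ) / |a|) with hκ
  have hκ0 : 0 < κ := Real.log_pos ((one_lt_div ha0).2 (by linarith))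
  have hlα : Real.log α < 0 := Real.log_neg hα0 hα1
  have hlD : 0 ≤ Real.log (|a| + δ) := Real.log_nonneg (by linarith)
  have hla : 0 ≤ Real.log |a| := Real.log_nonneg ha
  have hl2 : 0 < Real.log 2 := Real.log_pos (by norm_num)
  -- The weight for which the overflow drift `log (|a| + δ) - B * κ` per unit time equals the
  -- zoom-in drift `log α`.
  set B := (Real.log (|a| + δ) - Real.log α) / κ with hB
  have hB0 : 0 ≤ B := div_nonneg (by linarith) hκ0.le
  -- A decoding error costs at most `n * F`; the drift is also linear in `n`, so the error level
  -- `-log α / (4 * F)` does not depend on `n`.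
  set F := Real.log (|a| + δ) + B * (Real.log 2 + Real.log |a| - Real.log α + κ) - Real.log α
    with hF
  have hF0 : 0 < F := by
    have : 0 ≤ B * (Real.log 2 + Real.log |a| - Real.log α + κ) := mul_nonneg hB0 (by linarith)
    linarith
  set σ := ∫ z, |z| ∂gaussianReal 0 v with hσ
  have hσ0 : 0 ≤ σ := integral_nonneg fun z => abs_nonneg z
  have hlim : Filter.Tendsto (fun n : ℕ => B * (1 + 2 * κ) * (σ / L) * ((n : ℝ) ^ 2 * (S / T) ^ n))
      Filter.atTop (nhds 0) := by
    have h1 : |S / T| < 1 := by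
      rw [abs_of_pos (div_pos hS0 hT0)]
      exact (div_lt_one hT0).2 hST
    simpa using (tendsto_pow_const_mul_const_pow_of_abs_lt_one 2 h1).const_mul
      (B * (1 + 2 * κ) * (σ / L))
  -- The constant 5 comes from `2 * ⌈T ^ n⌉₊ + 1 ≤ 2 * T ^ n + 3 ≤ 5 * T ^ n`.
  have hev := (exists_blockCode_error_le W (by linarith) hTC 5
    (ε := -Real.log α / (4 * F)) (div_pos (by linarith) (by linarith))).and
    (hlim.eventually (gt_mem_nhds (show 0 < -Real.log α / 4 by linarith)))
  obtain ⟨n₀, hn₀⟩ := Filter.eventually_atTop.1 hev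
  refine ⟨n₀, fun n hn hnpos => ?_⟩
  obtain ⟨hcode, hsmall⟩ := hn₀ n hn
  have hn1 : (1 : ℝ) ≤ n := by exact_mod_cast hnpos
  have hTn : 1 ≤ T ^ n := one_le_pow₀ (by linarith)
  set K := 2 * ⌈T ^ n⌉₊ with hK
  have hKge : 2 * T ^ n ≤ K := by
    rw [hK]
    push_cast
    have := Nat.le_ceil (T ^ n)
    linarith
  have hceil : 0 < ⌈T ^ n⌉₊ := Nat.ceil_pos.2 (by linarith)
  have hKpos : (0 : ℝ) < K := by linarith
  obtain ⟨C, hε⟩ := hcode K (by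
    rw [hK]
    push_cast
    have := Nat.ceil_lt_add_one (show 0 ≤ T ^ n by linarith)
    linarith)
  have haαn : |a| ^ n / α ^ n ≤ S ^ n := by
    rw [← div_pow]
    gcongr
  have hSTn : S ^ n ≤ T ^ n := by gcongr
  have hβ : 0 < α ^ n := by positivity
  have hAK : 2 * |a| ^ n ≤ K * α ^ n := by
    rw [div_le_iff₀ hβ] at haαn
    nlinarith
  have hlogβ : Real.log (α ^ n) = n * Real.log α := Real.log_pow _ _
  have hlogD : Real.log ((|a| + δ) ^ n) = n * Real.log (|a| + δ) := Real.log_pow _ _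
  have hθ : n * κ = Real.log (((|a| + δ) / |a|) ^ n) := (Real.log_pow _ _).symm
  have hBκ : B * κ = Real.log (|a| + δ) - Real.log α := div_mul_cancel₀ _ hκ0.ne'
  have hdrift : Real.log ((|a| + δ) ^ n) - B * (n * κ) ≤ Real.log (α ^ n) := by
    rw [hlogβ, hlogD, mul_left_comm, hBκ]
    apply le_of_eq
    ring
  have herr : (Real.log ((|a| + δ) ^ n) + B * (Real.log (2 * |a| ^ n / α ^ n) + n * κ)
      - Real.log (α ^ n)) * (-Real.log α / (4 * F)) ≤ -Real.log (α ^ n) / 4 := by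
    have h1 : Real.log (2 * |a| ^ n / α ^ n) =
        Real.log 2 + n * Real.log |a| - n * Real.log α := by
      rw [Real.log_div (by positivity) hβ.ne', Real.log_mul (by norm_num) (by positivity),
        Real.log_pow, hlogβ]
    have h2 : Real.log ((|a| + δ) ^ n) + B * (Real.log (2 * |a| ^ n / α ^ n) + n * κ)
        - Real.log (α ^ n) ≤ n * F := by
      rw [h1, hlogβ, hlogD, hF]
      have : B * Real.log 2 ≤ n * (B * Real.log 2) :=
        le_mul_of_one_le_left (mul_nonneg hB0 hl2.le) hn1
      linarith
    refine (mul_le_mul_of_nonneg_right h2 (div_nonneg (by linarith) (by linarith))).trans_eq ?_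
    rw [hlogβ]
    field_simp
  have hnoise : B * (1 + 2 * (n * κ)) * (2 / (K * (α ^ n * L))) * (|a| ^ n * (n * σ)) ≤
      -Real.log (α ^ n) / 4 := by
    have h1 : 2 / (K : ℝ) ≤ 1 / T ^ n := by
      rw [div_le_div_iff₀ hKpos (by positivity)]
      linarith
    calc B * (1 + 2 * (n * κ)) * (2 / (K * (α ^ n * L))) * (|a| ^ n * (n * σ))
        = B * (1 + 2 * (n * κ)) * (n * σ / L) * ((2 / K) * (|a| ^ n / α ^ n)) := by
          field_simp
      _ ≤ B * (n * (1 + 2 * κ)) * (n * σ / L) * ((1 / T ^ n) * S ^ n) := by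
          have h2 : 1 + 2 * (n * κ) ≤ n * (1 + 2 * κ) := by linarith
          gcongr
      _ = B * (1 + 2 * κ) * (σ / L) * ((n : ℝ) ^ 2 * (S / T) ^ n) := by
          rw [div_pow]
          ring
      _ ≤ -Real.log α / 4 := hsmall.le
      _ ≤ n * (-Real.log α / 4) := le_mul_of_one_le_left (by linarith) hn1
      _ = -Real.log (α ^ n) / 4 := by
          rw [hlogβ]
          ring
  refine ⟨K, C, Set.Icc (-(K * L / 2)) (K * L / 2) ×ˢ Set.Icc (α ^ n * L) L, even_two_mul _,
    by omega, ?_, ?_, isCompact_Icc.prod isCompact_Icc, ?_, ?_⟩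
  · have : ⌈|a| ^ n⌉₊ ≤ ⌈T ^ n⌉₊ := Nat.ceil_mono (by gcongr)
    omega
  · rw [← Real.logb_pow, div_pow]
    exact Real.logb_lt_logb (by norm_num) (by positivity) (by linarith)
  · exact fun p hp => (by positivity : 0 < α ^ n * L).trans_le hp.2.1
  · intro Ω _ μ _ Δ₀ x d u Δ q q' hΔ₀ h
    exact h.isCoordinateRecurrent hb hnpos (by omega) ha hα0 hα1 hδ hL hΔ₀ hB0 hθ hdrift hAK hε
      (div_nonneg (by linarith) (by linarith)) herr hnoise
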